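/- There exist absolute constants $C>0$ and $K$ such that the following holds. Let $d\ge 3$, let $G$ be a finite simple $d$-regular graph on $m$ vertices, and let $\lambda$ be such that every nontrivial eigenvalue of $G$ is at most $\lambda$ in absolute value, where the nontrivial eigenvalues of a graph on $N$ vertices are $\lambda_2,\dots,\lambda_N$ if $\lambda_1\ge\lambda_2\ge\dots\ge\lambda_N$ are the eigenvalues of its adjacency matrix counted with multiplicity. Put $\rho=2\sqrt{d-1}$, the spectral radius of the universal cover of $G$. Let $H$ be a random $n$-lift of $G$: the graph on $[n]\times V(G)$ where for each edge $uv$ of $G$ there is an independent uniform bijection $\pi$ of $[n]$, and the edges of $H$ over $uv$ are the pairs $(i,u),(\pi(i),v)$, $i\in[n]$. Let $p_n$ be the probability that some nontrivial eigenvalue of $H$ exceeds $C\max(\lambda,\rho)\log_2\rho$ in absolute value. Then 1. for $G$ and $\lambda$ fixed, $p_n=O(n^{-100})$: there is a constant $K'$, which may depend on $G$ and $\lambda$, with $p_n\le K' n^{-100}$ for all $n\ge 1$; 2. moreover, the implied constant is absolute when $n$ is large compared with $m$: $p_n\le K n^{-100}$ for all $n\ge m^{3/2}$. -/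

import Mathlib

/-- The real adjacency matrix of a finite simple graph. -/
noncomputable def adjacencyMatrix {W : Type*} (H : SimpleGraph W) : Matrix W W ℝ :=
  open Classical in H.adjMatrix ℝ

theorem adjacencyMatrix_isHermitian {W : Type*} (H : SimpleGraph W) :
    (adjacencyMatrix H).IsHermitian := by
  classical
  unfold adjacencyMatrix
  rw [Matrix.IsHermitian, Matrix.conjTranspose_eq_transpose_of_trivial]
  exact H.isSymm_adjMatrix

/-- The eigenvalues `λ₁ ≥ λ₂ ≥ … ≥ λ_N` of the adjacency matrix, counted with multiplicity and
listed in decreasing order; the list is indexed from `0`, so that `graphEigenvalue H 0` is `λ₁`. -/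
noncomputable def graphEigenvalue {W : Type*} [Fintype W] (H : SimpleGraph W) :
    Fin (Fintype.card W) → ℝ :=
  open Classical in (adjacencyMatrix_isHermitian H).eigenvalues₀

/-- Every nontrivial eigenvalue, that is every `λ_i` with `i ≠ 1`, is at most `b` in absolute
value. -/
def NontrivialEigenvaluesLE {W : Type*} [Fintype W] (H : SimpleGraph W) (b : ℝ) : Prop :=
  ∀ i : Fin (Fintype.card W), (i : ℕ) ≠ 0 → |graphEigenvalue H i| ≤ b

/-- A choice of one bijection of `[n]` for every edge of `G`. -/
abbrev LiftData {V : Type*} (G : SimpleGraph V) (n : ℕ) : Type _ :=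
  G.edgeSet → Equiv.Perm (Fin n)

/-- The `n`-lift of `G` on the vertices `[n] × V` given by the bijections `π`. Every edge `e` of `G`
is read as an ordered pair `(u, v)` of its endpoints (`Quot.out` picks one of the two orders), and
then the edges of the lift over `e` are the pairs `(i, u), (π e i, v)`. -/
def liftGraph {V : Type*} (G : SimpleGraph V) (n : ℕ) (π : LiftData G n) :
    SimpleGraph (Fin n × V) :=
  SimpleGraph.fromRel fun x y =>
    ∃ e : G.edgeSet, Quot.out (e : Sym2 V) = (x.2, y.2) ∧ π e x.1 = y.1

/-- The probability that a random `n`-lift of the finite graph `G` satisfies `E`, where the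
bijections attached to the edges of `G` are independent and uniform; that is, the family of
bijections is uniform on the finite product set `LiftData G n`. -/
noncomputable def liftProbability {V : Type*} (G : SimpleGraph V) (n : ℕ)
    (E : SimpleGraph (Fin n × V) → Prop) : ℝ :=
  (Nat.card {π : LiftData G n // E (liftGraph G n π)} : ℝ) / (Nat.card (LiftData G n) : ℝ)

/-- The spectral radius `2 √(d - 1)` of the infinite `d`-regular tree. -/
noncomputable def treeSpectralRadius (d : ℕ) : ℝ := 2 * Real.sqrt ((d : ℝ) - 1)

/-! ### Uniform permutations -/

/-! Put α = max(λ, ρ). On a function f with sum zero, the quadratic form of the lift is its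
expectation plus twice a deviation (`quadratic_form_liftGraph_eq`). The expectation is the form of G
on the fibre sums of f, divided by n, and the spectral bound on G makes it at most α‖f‖². Everything
else bounds the deviation by O(α log d)‖f‖².

Concentration. The number of points of A sent into B by a uniform permutation has a moment
generating function of Poisson type. Chernoff bounds and a union bound over all pairs (S, T) of
subsets of the lift fail with probability O(n⁻¹⁰⁰) (`card_not_concentrated_le`). The price is an
exponent proportional to the entropy, the sum of k(1 + log(n/k)) over the fibre sizes k. The union
bound is where n ≥ m enters.

Discrepancy. The entropy exceeds |S| + |T| by logarithms that are unbounded on sparse fibres. Edges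
at which the smaller fibre has density at most d⁻⁴ are therefore counted with weight log(n/k)/2; a
dyadic decomposition in the logarithm of the density then cancels that logarithm, and there are
O(|S| + |T|) such hits (`sum_thin_hits_le`). On the other fibres the logarithm is at most 4 log d,
and the mixing lemma in G bounds the mean. The outcome, `abs_discrepancy_le`, is an error
O(α√(|S||T|) + log d (|S| + |T|)).

Quadratic form. As in the converse mixing lemma of Bilu and Linial, vectors are cut into level sets,
here binary digits. Digits at distance at most h are controlled by the discrepancy, distant ones by
the degree alone; 2^h ≈ √d balances the two and costs one factor log d (`abs_deviationForm_le`). -/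

open Finset in
-- Among the permutations that send `A` into `B`, transpositions show that all points outside `A`
-- are equally likely to land in `B`. Exactly |B| − |A| of these n − |A| points do, and (|B| −
-- |A|)/(n − |A|) ≤ |B|/n.
theorem card_perm_mapsTo_le {α : Type*} [Fintype α] [DecidableEq α] (A B : Finset α) :
    (#{π : Equiv.Perm α | ∀ i ∈ A, π i ∈ B} : ℝ) ≤
      ((#B : ℝ) / Fintype.card α) ^ #A * (Fintype.card α).factorial := by
  induction A using Finset.induction_on with
  | empty => simp [Fintype.card_perm]
  | insert a A ha ih =>
    set P : Finset (Equiv.Perm α) := {π | ∀ i ∈ A, π i ∈ B} with hP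
    set Q : α → Finset (Equiv.Perm α) := fun b => {π ∈ P | π b ∈ B} with hQ
    have hQa : ({π : Equiv.Perm α | ∀ i ∈ insert a A, π i ∈ B} : Finset _) = Q a := by
      ext π
      simp [hQ, hP, and_comm]
    rw [hQa]
    have hswap : ∀ b ∈ Aᶜ, #(Q b) = #(Q a) := by
      intro b hb
      rw [mem_compl] at hb
      refine card_bij' (fun π _ => π * Equiv.swap a b) (fun π _ => π * Equiv.swap a b) ?_ ?_ ?_ ?_
      · intro π hπ
        simp only [hQ, hP, mem_filter, mem_univ, true_and] at hπ ⊢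
        refine ⟨fun i hi => ?_, by simpa using hπ.2⟩
        have h1 : i ≠ a := fun h => ha (h ▸ hi)
        have h2 : i ≠ b := fun h => hb (h ▸ hi)
        simpa [Equiv.swap_apply_of_ne_of_ne h1 h2] using hπ.1 i hi
      · intro π hπ
        simp only [hQ, hP, mem_filter, mem_univ, true_and] at hπ ⊢
        refine ⟨fun i hi => ?_, by simpa using hπ.2⟩
        have h1 : i ≠ a := fun h => ha (h ▸ hi)
        have h2 : i ≠ b := fun h => hb (h ▸ hi)
        simpa [Equiv.swap_apply_of_ne_of_ne h1 h2] using hπ.1 i hi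
      · intro π _; ext; simp
      · intro π _; ext; simp
    have hcount : ∀ π ∈ P, ((#{b ∈ Aᶜ | π b ∈ B} : ℕ) : ℝ) = (#B : ℝ) - #A := by
      intro π hπ
      have h1 : #({b | π b ∈ B} : Finset α) = #B := by
        refine card_bij' (fun b _ => π b) (fun b _ => π.symm b) ?_ ?_ ?_ ?_ <;> simp
      have h2 : ({b | π b ∈ B} : Finset α) = {b ∈ Aᶜ | π b ∈ B} ∪ A := by
        ext b
        simp only [hP, mem_filter, mem_univ, true_and] at hπ
        simp only [mem_filter, mem_univ, true_and, mem_union, mem_compl]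
        by_cases hb : b ∈ A
        · simp [hb, hπ b hb]
        · simp [hb]
      have h3 : Disjoint ({b ∈ Aᶜ | π b ∈ B} : Finset α) A := by
        rw [disjoint_left]
        intro b hb
        simpa using (mem_filter.1 hb).1
      rw [h2, card_union_of_disjoint h3] at h1
      rw [← h1]; push_cast; ring
    have hdouble : ∑ b ∈ Aᶜ, (#(Q b) : ℝ) = ∑ π ∈ P, ((#{b ∈ Aᶜ | π b ∈ B} : ℕ) : ℝ) := by
      simp only [hQ, card_filter]
      push_cast
      rw [sum_comm]
    rw [sum_congr rfl hcount, sum_congr rfl (fun b hb => by rw [hswap b hb]), sum_const, sum_const,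
      card_compl, nsmul_eq_mul, nsmul_eq_mul,
      Nat.cast_sub (card_le_univ A)] at hdouble
    have hA : (#A : ℝ) + 1 ≤ Fintype.card α := by
      have := card_le_univ (insert a A)
      rw [card_insert_of_notMem ha] at this
      exact_mod_cast this
    have hB : (#B : ℝ) ≤ Fintype.card α := by exact_mod_cast card_le_univ B
    have hn : (0 : ℝ) < Fintype.card α := by have : (0 : ℝ) ≤ #A := by positivity
                                             linarith
    have hstep : (#(Q a) : ℝ) ≤ (#B : ℝ) / Fintype.card α * #P := by
      rw [div_mul_eq_mul_div, le_div_iff₀ hn]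
      have hk : (0 : ℝ) < Fintype.card α - #A := by linarith
      have hP0 : (0 : ℝ) ≤ #P := by positivity
      have hA0 : (0 : ℝ) ≤ #A := by positivity
      refine le_of_mul_le_mul_left ?_ hk
      calc ((Fintype.card α : ℝ) - #A) * (#(Q a) * Fintype.card α)
          = #P * ((#B - #A) * Fintype.card α) := by rw [← mul_assoc, hdouble]; ring
        _ ≤ #P * ((Fintype.card α - #A) * #B) := by
            refine mul_le_mul_of_nonneg_left ?_ hP0
            nlinarith [mul_le_mul_of_nonneg_left hB hA0]
        _ = _ := by ring
    rw [card_insert_of_notMem ha, pow_succ]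
    calc (#(Q a) : ℝ) ≤ (#B : ℝ) / Fintype.card α * #P := hstep
      _ ≤ (#B : ℝ) / Fintype.card α * (((#B : ℝ) / Fintype.card α) ^ #A *
            (Fintype.card α).factorial) := mul_le_mul_of_nonneg_left ih (by positivity)
      _ = _ := by ring

open Finset in
-- Expanding the power over the subsets of `A` reduces this to `card_perm_mapsTo_le`; `0 ≤ z` keeps
-- the coefficients nonnegative.
theorem sum_perm_one_add_pow_le {α : Type*} [Fintype α] [DecidableEq α] (A B : Finset α)
    {z : ℝ} (hz : 0 ≤ z) :
    ∑ π : Equiv.Perm α, (1 + z) ^ #{i ∈ A | π i ∈ B} ≤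
      (Fintype.card α).factorial * (1 + z * ((#B : ℝ) / Fintype.card α)) ^ #A := by
  have hexp : ∀ π : Equiv.Perm α, (1 + z) ^ #{i ∈ A | π i ∈ B} =
      ∑ A' ∈ A.powerset, z ^ #A' * (if ∀ i ∈ A', π i ∈ B then 1 else 0) := by
    intro π
    have h1 : (1 + z) ^ #{i ∈ A | π i ∈ B} = ∏ i ∈ A, (1 + if π i ∈ B then z else 0) := by
      rw [← prod_const, prod_filter]
      refine prod_congr rfl fun i _ => ?_
      split_ifs <;> simp
    rw [h1, prod_one_add]
    refine sum_congr rfl fun A' _ => ?_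
    split_ifs with h
    · rw [mul_one, ← prod_const]
      exact prod_congr rfl fun i hi => by rw [if_pos (h i hi)]
    · push Not at h
      obtain ⟨i, hi, hi'⟩ := h
      rw [mul_zero]
      exact prod_eq_zero hi (by simp [hi'])
  calc ∑ π : Equiv.Perm α, (1 + z) ^ #{i ∈ A | π i ∈ B}
      = ∑ A' ∈ A.powerset, z ^ #A' * (#{π : Equiv.Perm α | ∀ i ∈ A', π i ∈ B} : ℝ) := by
        rw [sum_congr rfl fun π _ => hexp π, sum_comm]
        refine sum_congr rfl fun A' _ => ?_
        rw [← mul_sum]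
        simp
    _ ≤ ∑ A' ∈ A.powerset, z ^ #A' * (((#B : ℝ) / Fintype.card α) ^ #A' *
          (Fintype.card α).factorial) :=
        sum_le_sum fun A' _ => mul_le_mul_of_nonneg_left (card_perm_mapsTo_le A' B) (by positivity)
    _ = (Fintype.card α).factorial *
          ∑ A' ∈ A.powerset, (z * ((#B : ℝ) / Fintype.card α)) ^ #A' * 1 ^ (#A - #A') := by
        rw [mul_sum]
        refine sum_congr rfl fun A' _ => ?_
        rw [mul_pow, one_pow]; ring
    _ = _ := by rw [sum_pow_mul_eq_add_pow, add_comm]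

open Finset in
/-- The moment generating function of the number of elements of `A` sent into `B` by a uniform
permutation is at most that of a Poisson variable with the same mean. -/
theorem sum_perm_exp_le {α : Type*} [Fintype α] [DecidableEq α] (A B : Finset α) (t : ℝ) :
    ∑ π : Equiv.Perm α, Real.exp (t * #{i ∈ A | π i ∈ B}) ≤
      (Fintype.card α).factorial *
        Real.exp ((Real.exp t - 1) * ((#A : ℝ) * #B / Fintype.card α)) := by
  rcases isEmpty_or_nonempty α with hα | hα
  · have hA : A = ∅ := Subsingleton.elim _ _
    subst hA
    simp
  have hn : (0 : ℝ) < Fintype.card α := by exact_mod_cast Fintype.card_pos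
  set p : ℝ := (#B : ℝ) / Fintype.card α with hp
  have hp0 : 0 ≤ p := by positivity
  have hp1 : p ≤ 1 := by
    rw [hp, div_le_one hn]; exact_mod_cast card_le_univ B
  have key : ∑ π : Equiv.Perm α, Real.exp (t * #{i ∈ A | π i ∈ B}) ≤
      (Fintype.card α).factorial * (1 + (Real.exp t - 1) * p) ^ #A := by
    rcases le_total 0 t with ht | ht
    · have := sum_perm_one_add_pow_le A B (z := Real.exp t - 1)
        (by linarith [Real.add_one_le_exp t])
      refine le_trans (le_of_eq (sum_congr rfl fun π _ => ?_)) this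
      rw [mul_comm, Real.exp_nat_mul]; congr 1; ring
    -- For negative `t`, counting the points sent outside `B` turns the parameter into -t ≥ 0.
    · have := sum_perm_one_add_pow_le A Bᶜ (z := Real.exp (-t) - 1)
        (by linarith [Real.add_one_le_exp (-t)])
      have hcompl : ((#Bᶜ : ℕ) : ℝ) / Fintype.card α = 1 - p := by
        rw [card_compl, Nat.cast_sub (card_le_univ B), hp]; field_simp
      rw [hcompl] at this
      have h2 : ∀ π : Equiv.Perm α, Real.exp (t * #{i ∈ A | π i ∈ B}) =
          Real.exp t ^ #A * (1 + (Real.exp (-t) - 1)) ^ #{i ∈ A | π i ∈ Bᶜ} := by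
        intro π
        have h3 : #{i ∈ A | π i ∈ B} + #{i ∈ A | π i ∈ Bᶜ} = #A := by
          simp only [mem_compl]
          exact card_filter_add_card_filter_not _
        rw [show 1 + (Real.exp (-t) - 1) = Real.exp (-t) by ring, ← Real.exp_nat_mul,
          ← Real.exp_nat_mul, ← Real.exp_add, ← h3]
        push_cast; congr 1; ring
      rw [sum_congr rfl fun π _ => h2 π, ← mul_sum]
      calc _ ≤ Real.exp t ^ #A * ((Fintype.card α).factorial *
            (1 + (Real.exp (-t) - 1) * (1 - p)) ^ #A) := by gcongr
        _ = (Fintype.card α).factorial *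
            (Real.exp t * (1 + (Real.exp (-t) - 1) * (1 - p))) ^ #A := by rw [mul_pow]; ring
        _ = _ := by
            congr 2
            have : Real.exp t * Real.exp (-t) = 1 := by rw [← Real.exp_add]; simp
            linear_combination (1 - p) * this
  refine key.trans ?_
  refine mul_le_mul_of_nonneg_left ?_ (by positivity)
  have h0 : 0 ≤ 1 + (Real.exp t - 1) * p := by nlinarith [Real.exp_pos t]
  calc (1 + (Real.exp t - 1) * p) ^ #A ≤ Real.exp ((Real.exp t - 1) * p) ^ #A := by
        refine pow_le_pow_left₀ h0 ?_ _
        linarith [Real.add_one_le_exp ((Real.exp t - 1) * p)]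
    _ = _ := by
        rw [← Real.exp_nat_mul]; congr 1; rw [hp]; ring

/-! ### Entropy of a subset of a fibre -/

/-- An upper bound for the logarithm of the number of `k`-element subsets of an `n`-set. -/
noncomputable def fiberEntropy (n k : ℕ) : ℝ := k * (1 + Real.log (n / k))

theorem fiberEntropy_zero (n : ℕ) : fiberEntropy n 0 = 0 := by simp [fiberEntropy]

theorem log_div_nonneg {n k : ℕ} (hkn : k ≤ n) : 0 ≤ Real.log ((n : ℝ) / k) := by
  rcases Nat.eq_zero_or_pos k with rfl | hk
  · simp
  · refine Real.log_nonneg ?_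
    rw [le_div_iff₀ (by exact_mod_cast hk)]
    simpa using hkn

theorem fiberEntropy_nonneg {n k : ℕ} (hkn : k ≤ n) : 0 ≤ fiberEntropy n k := by
  have := log_div_nonneg hkn
  unfold fiberEntropy; positivity

theorem fiberEntropy_le {n k : ℕ} (hkn : k ≤ n) : fiberEntropy n k ≤ n := by
  rcases Nat.eq_zero_or_pos k with rfl | hk
  · simp [fiberEntropy]
  · have hk' : (0 : ℝ) < k := by exact_mod_cast hk
    have hn : (0 : ℝ) < n := by exact_mod_cast hk.trans_le hkn
    have := Real.log_le_sub_one_of_pos (div_pos hn hk')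
    calc fiberEntropy n k ≤ k * ((n : ℝ) / k) := by
          unfold fiberEntropy
          exact mul_le_mul_of_nonneg_left (by linarith) hk'.le
      _ = n := by field_simp

/-- This turns entropy into powers of `n`: a single point in a fibre already carries entropy 1 + log
n. -/
theorem one_add_log_le_fiberEntropy {n k : ℕ} (hk : 0 < k) (hkn : k ≤ n) :
    1 + Real.log n ≤ fiberEntropy n k := by
  have hk' : (1 : ℝ) ≤ k := by exact_mod_cast hk
  have hn : (0 : ℝ) < n := by exact_mod_cast hk.trans_le hkn
  have h1 := log_div_nonneg hkn
  have h2 := Real.log_le_sub_one_of_pos (show (0 : ℝ) < k by linarith)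
  have h3 : Real.log n = Real.log ((n : ℝ) / k) + Real.log k := by
    rw [Real.log_div hn.ne' (by linarith)]; ring
  unfold fiberEntropy
  rw [h3]
  nlinarith

theorem choose_le_exp_fiberEntropy {n k : ℕ} (hkn : k ≤ n) :
    (n.choose k : ℝ) ≤ Real.exp (fiberEntropy n k) := by
  rcases Nat.eq_zero_or_pos k with rfl | hk
  · simp [fiberEntropy]
  · have hk' : (0 : ℝ) < k := by exact_mod_cast hk
    have hn : (0 : ℝ) < n := by exact_mod_cast hk.trans_le hkn
    have h1 : (n.choose k : ℝ) ≤ (n : ℝ) ^ k / k.factorial := Nat.choose_le_pow_div k n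
    have h2 := Real.pow_div_factorial_le_exp (k : ℝ) hk'.le k
    have hf : (0 : ℝ) < k.factorial := by positivity
    rw [div_le_iff₀ hf] at h2
    have h3 : Real.exp (fiberEntropy n k) = Real.exp k * ((n : ℝ) / k) ^ k := by
      unfold fiberEntropy
      rw [mul_add, mul_one, Real.exp_add, Real.exp_nat_mul (Real.log _), Real.exp_log (by positivity)]
    refine h1.trans ?_
    rw [h3, div_le_iff₀ hf, div_pow, mul_div_assoc', div_mul_eq_mul_div,
      le_div_iff₀ (by positivity)]
    nlinarith [pow_pos hn k]

open Finset in
-- One of the three entropies pays for the binomial coefficient and the other two leave n⁻² for each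
-- nonzero size. The `n` sizes add 1/n to the empty set's 1, little enough to survive a product over
-- up to `n` fibres.
theorem sum_exp_neg_fiberEntropy_le (n : ℕ) (hn : 1 ≤ n) :
    ∑ A : Finset (Fin n), Real.exp (-3 * fiberEntropy n #A) ≤ Real.exp (1 / n) := by
  have hn' : (0 : ℝ) < n := by exact_mod_cast hn
  have h0 := sum_powerset_apply_card (f := fun k => Real.exp (-3 * fiberEntropy n k))
    (x := (univ : Finset (Fin n)))
  rw [powerset_univ, card_univ, Fintype.card_fin] at h0
  rw [h0, sum_range_succ']
  have hterm : ∀ k ∈ range n, (n.choose (k + 1)) • Real.exp (-3 * fiberEntropy n (k + 1)) ≤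
      1 / (n : ℝ) ^ 2 := by
    intro k hk
    have hkn : k + 1 ≤ n := by simpa using hk
    have h1 := choose_le_exp_fiberEntropy hkn
    have h2 := one_add_log_le_fiberEntropy (Nat.succ_pos k) hkn
    rw [nsmul_eq_mul]
    calc (n.choose (k + 1) : ℝ) * Real.exp (-3 * fiberEntropy n (k + 1))
        ≤ Real.exp (fiberEntropy n (k + 1)) * Real.exp (-3 * fiberEntropy n (k + 1)) := by gcongr
      _ = Real.exp (-2 * fiberEntropy n (k + 1)) := by rw [← Real.exp_add]; congr 1; ring
      _ ≤ Real.exp (-((2 : ℕ) * Real.log n)) := by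
          rw [Real.exp_le_exp]; push_cast
          linarith
      _ = 1 / (n : ℝ) ^ 2 := by
          rw [Real.exp_neg, Real.exp_nat_mul, Real.exp_log hn', one_div]
  have hsum := sum_le_sum hterm
  rw [sum_const, card_range, nsmul_eq_mul] at hsum
  have h4 : (n : ℝ) * (1 / (n : ℝ) ^ 2) = 1 / n := by field_simp
  rw [h4] at hsum
  have := Real.add_one_le_exp (1 / (n : ℝ))
  simp only [Nat.choose_zero_right, fiberEntropy_zero, mul_zero, Real.exp_zero, one_smul]
  linarith

/-! ### Concentration of the number of hits -/

open Finset in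
/-- The number of edges over `e` from `S` to `T`, in the lift given by `π`. -/
def hits {V ι : Type*} (a b : ι → V) {n : ℕ} (S T : V → Finset (Fin n))
    (π : ι → Equiv.Perm (Fin n)) (e : ι) : ℕ :=
  #{i ∈ S (a e) | π e i ∈ T (b e)}

open Finset in
/-- The expectation of `hits` for a uniform `π`. -/
noncomputable def meanHits {V ι : Type*} (a b : ι → V) {n : ℕ} (S T : V → Finset (Fin n))
    (e : ι) : ℝ :=
  (#(S (a e)) : ℝ) * #(T (b e)) / n

open Finset in
/-- The entropy of a subset of the lift, given by its fibres. -/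
noncomputable def setEntropy {V : Type*} [Fintype V] {n : ℕ} (S : V → Finset (Fin n)) : ℝ :=
  ∑ u, fiberEntropy n #(S u)

/-- The exponent in the tail bounds for the pair `S, T`. -/
noncomputable def pairExponent {V : Type*} [Fintype V] {n : ℕ} (S T : V → Finset (Fin n)) : ℝ :=
  103 * (setEntropy S + setEntropy T)

section

variable {V ι : Type*} {n : ℕ}

open Finset

theorem meanHits_nonneg (a b : ι → V) (S T : V → Finset (Fin n)) (e : ι) :
    0 ≤ meanHits a b S T e := by
  unfold meanHits; positivity

theorem card_fin_le (A : Finset (Fin n)) : #A ≤ n := by simpa using card_le_univ A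

theorem card_le_fiberEntropy (A : Finset (Fin n)) : (#A : ℝ) ≤ fiberEntropy n #A := by
  have := log_div_nonneg (card_fin_le A)
  unfold fiberEntropy
  nlinarith [show (0 : ℝ) ≤ #A by positivity]

theorem setEntropy_nonneg [Fintype V] (S : V → Finset (Fin n)) : 0 ≤ setEntropy S :=
  sum_nonneg fun u _ => fiberEntropy_nonneg (card_fin_le (S u))

theorem pairExponent_nonneg [Fintype V] (S T : V → Finset (Fin n)) : 0 ≤ pairExponent S T := by
  have := setEntropy_nonneg S
  have := setEntropy_nonneg T
  unfold pairExponent; positivity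

theorem one_add_log_le_setEntropy [Fintype V] (S : V → Finset (Fin n)) (hS : S ≠ fun _ => ∅) :
    1 + Real.log n ≤ setEntropy S := by
  obtain ⟨u, hu⟩ : ∃ u, S u ≠ ∅ := by
    by_contra! h
    exact hS (funext h)
  refine (one_add_log_le_fiberEntropy (card_pos.2 (nonempty_iff_ne_empty.2 hu))
    (card_fin_le (S u))).trans ?_
  exact single_le_sum (f := fun u => fiberEntropy n #(S u))
    (fun u _ => fiberEntropy_nonneg (card_fin_le (S u))) (mem_univ u)

/-- The permutations of different edges are independent, so the sum factors over the edges. -/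
theorem sum_exp_mul_hits_le [Fintype ι] [DecidableEq ι] (a b : ι → V) (S T : V → Finset (Fin n)) (t : ι → ℝ) :
    ∑ π : ι → Equiv.Perm (Fin n), Real.exp (∑ e, t e * hits a b S T π e) ≤
      Fintype.card (ι → Equiv.Perm (Fin n)) *
        Real.exp (∑ e, (Real.exp (t e) - 1) * meanHits a b S T e) := by
  classical
  have h1 : ∑ π : ι → Equiv.Perm (Fin n), Real.exp (∑ e, t e * hits a b S T π e) =
      ∏ e, ∑ σ : Equiv.Perm (Fin n), Real.exp (t e * #{i ∈ S (a e) | σ i ∈ T (b e)}) := by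
    rw [prod_univ_sum]
    simp only [Fintype.piFinset_univ]
    exact sum_congr rfl fun π _ => Real.exp_sum _ _
  rw [h1]
  calc _ ≤ ∏ e : ι, ((n.factorial : ℝ) *
        Real.exp ((Real.exp (t e) - 1) * meanHits a b S T e)) := by
        refine prod_le_prod (fun e _ => sum_nonneg fun _ _ => (Real.exp_pos _).le) fun e _ => ?_
        simpa [meanHits] using sum_perm_exp_le (S (a e)) (T (b e)) (t e)
    _ = _ := by
        rw [prod_mul_distrib, prod_const, ← Real.exp_sum]
        simp [Fintype.card_perm]

/-- Chernoff's bound: Markov's inequality for the exponential moment. -/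
theorem card_lt_sum_mul_hits_le [Fintype ι] [DecidableEq ι] (a b : ι → V)
    (S T : V → Finset (Fin n)) (t : ι → ℝ) (E : ℝ) :
    (Nat.card {π : ι → Equiv.Perm (Fin n) //
      ∑ e, (Real.exp (t e) - 1) * meanHits a b S T e + E < ∑ e, t e * hits a b S T π e} : ℝ) ≤
      Fintype.card (ι → Equiv.Perm (Fin n)) * Real.exp (-E) := by
  classical
  have hmgf := sum_exp_mul_hits_le a b S T t
  set M := ∑ e, (Real.exp (t e) - 1) * meanHits a b S T e with hM
  rw [Nat.card_eq_fintype_card, Fintype.card_subtype]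
  set F : Finset (ι → Equiv.Perm (Fin n)) := {π | M + E < ∑ e, t e * hits a b S T π e} with hF
  have h1 : (#F : ℝ) * Real.exp (M + E) ≤
      ∑ π : ι → Equiv.Perm (Fin n), Real.exp (∑ e, t e * hits a b S T π e) := by
    rw [← nsmul_eq_mul, ← sum_const]
    refine (sum_le_sum fun π hπ => ?_).trans
      (sum_le_sum_of_subset_of_nonneg (subset_univ F) fun _ _ _ => (Real.exp_pos _).le)
    rw [Real.exp_le_exp]
    exact (mem_filter.1 hπ).2.le
  have h2 := h1.trans hmgf
  rw [Real.exp_add] at h2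
  rw [Real.exp_neg, ← div_eq_mul_inv, le_div_iff₀ (Real.exp_pos E)]
  refine le_of_mul_le_mul_right ?_ (Real.exp_pos M)
  linarith

theorem sum_exp_neg_setEntropy_le [Fintype V] [DecidableEq V] (hn : 1 ≤ n)
    (hm : Fintype.card V ≤ n) :
    ∑ S : V → Finset (Fin n), Real.exp (-3 * setEntropy S) ≤ Real.exp 1 := by
  have hn' : (0 : ℝ) < n := by exact_mod_cast hn
  have h1 : ∑ S : V → Finset (Fin n), Real.exp (-3 * setEntropy S) =
      ∏ _u : V, ∑ A : Finset (Fin n), Real.exp (-3 * fiberEntropy n #A) := by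
    rw [prod_univ_sum]
    simp only [Fintype.piFinset_univ]
    refine sum_congr rfl fun S _ => ?_
    rw [setEntropy, mul_sum, Real.exp_sum]
  rw [h1, prod_const, card_univ]
  calc _ ≤ Real.exp (1 / n) ^ Fintype.card V :=
        pow_le_pow_left₀ (sum_nonneg fun _ _ => (Real.exp_pos _).le)
          (sum_exp_neg_fiberEntropy_le n hn) _
    _ ≤ Real.exp 1 := by
        rw [← Real.exp_nat_mul, Real.exp_le_exp, mul_one_div, div_le_one hn']
        exact_mod_cast hm

/-- Simultaneous exponential tail bound over all pairs of subsets of the lift, with weights that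
may depend on the pair. -/
theorem card_exists_lt_sum_mul_hits_le [Fintype V] [Fintype ι] (a b : ι → V) (hn : 1 ≤ n)
    (hm : Fintype.card V ≤ n)
    (t : (V → Finset (Fin n)) → (V → Finset (Fin n)) → ι → ℝ) :
    (Nat.card {π : ι → Equiv.Perm (Fin n) // ∃ S T : V → Finset (Fin n),
      ∑ e, (Real.exp (t S T e) - 1) * meanHits a b S T e + pairExponent S T <
        ∑ e, t S T e * hits a b S T π e} : ℝ) ≤
      Nat.card (ι → Equiv.Perm (Fin n)) * (Real.exp 2 / (n : ℝ) ^ 100) := by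
  classical
  have hn' : (0 : ℝ) < n := by exact_mod_cast hn
  set bad : (V → Finset (Fin n)) → (V → Finset (Fin n)) → (ι → Equiv.Perm (Fin n)) → Prop :=
    fun S T π => ∑ e, (Real.exp (t S T e) - 1) * meanHits a b S T e + pairExponent S T <
        ∑ e, t S T e * hits a b S T π e with hbad
  have hone : ∀ S T, (#{π | bad S T π} : ℝ) ≤ Nat.card (ι → Equiv.Perm (Fin n)) *
      (1 / (n : ℝ) ^ 100 * (Real.exp (-3 * setEntropy S) * Real.exp (-3 * setEntropy T))) := by
    intro S T
    -- The pair of empty sets has entropy zero, hence no decay; but both sides of its inequality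
    -- vanish, so it is never bad.
    by_cases hST : S = (fun _ => ∅) ∧ T = fun _ => ∅
    · have : ({π | bad S T π} : Finset _) = ∅ := by
        obtain ⟨rfl, rfl⟩ := hST
        ext π
        simp [hbad, hits, meanHits, pairExponent, setEntropy, fiberEntropy]
      rw [this]
      simp only [card_empty, Nat.cast_zero]
      positivity
    · have hX : 1 + Real.log n ≤ setEntropy S + setEntropy T := by
        have h1 := setEntropy_nonneg S
        have h2 := setEntropy_nonneg T
        by_cases hS : S = fun _ => ∅
        · have := one_add_log_le_setEntropy T fun hT => hST ⟨hS, hT⟩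
          linarith
        · have := one_add_log_le_setEntropy S hS
          linarith
      have h1 := card_lt_sum_mul_hits_le a b S T (t S T) (pairExponent S T)
      rw [Nat.card_eq_fintype_card, Fintype.card_subtype] at h1
      rw [Nat.card_eq_fintype_card]
      refine h1.trans (mul_le_mul_of_nonneg_left ?_ (by positivity))
      -- Here 103 = 100 + 3: a hundred entropies give n⁻¹⁰⁰, three make the union bound summable.
      calc Real.exp (-pairExponent S T) ≤ Real.exp (-((100 : ℕ) * Real.log n) +
            (-3 * setEntropy S + -3 * setEntropy T)) := by
            rw [Real.exp_le_exp, pairExponent]; push_cast; linarith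
        _ = _ := by
            rw [Real.exp_add, Real.exp_add, Real.exp_neg, Real.exp_nat_mul, Real.exp_log hn',
              one_div]
  rw [Nat.card_eq_fintype_card (α := {π // _}), Fintype.card_subtype]
  have hsub : ({π | ∃ S T, bad S T π} : Finset (ι → Equiv.Perm (Fin n))) ⊆
      univ.biUnion fun S => univ.biUnion fun T => {π | bad S T π} := by
    intro π hπ
    simpa using hπ
  have hsum := sum_exp_neg_setEntropy_le (V := V) hn hm
  have hnn : 0 ≤ ∑ S : V → Finset (Fin n), Real.exp (-3 * setEntropy S) :=
    sum_nonneg fun _ _ => (Real.exp_pos _).le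
  calc (#{π | ∃ S T, bad S T π} : ℝ)
      ≤ ∑ S, ∑ T, (#{π | bad S T π} : ℝ) := by
        have h := (card_le_card hsub).trans (card_biUnion_le.trans
          (sum_le_sum fun S _ => card_biUnion_le))
        exact_mod_cast h
    _ ≤ ∑ S : V → Finset (Fin n), ∑ T : V → Finset (Fin n),
        (Nat.card (ι → Equiv.Perm (Fin n)) * (1 / (n : ℝ) ^ 100 *
          (Real.exp (-3 * setEntropy S) * Real.exp (-3 * setEntropy T)))) :=
        sum_le_sum fun S _ => sum_le_sum fun T _ => hone S T
    _ = Nat.card (ι → Equiv.Perm (Fin n)) * (1 / (n : ℝ) ^ 100 *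
        ((∑ S : V → Finset (Fin n), Real.exp (-3 * setEntropy S)) *
          ∑ S : V → Finset (Fin n), Real.exp (-3 * setEntropy S))) := by
        simp only [← mul_sum, sum_mul]
    _ ≤ Nat.card (ι → Equiv.Perm (Fin n)) * (1 / (n : ℝ) ^ 100 * (Real.exp 1 * Real.exp 1)) := by
        gcongr
    _ = _ := by rw [← Real.exp_add]; norm_num; ring

/-- The exponential parameter used for the pair `S, T` in the two-sided tail bound. -/
noncomputable def tailParameter [Fintype V] [Fintype ι] (a b : ι → V)
    (S T : V → Finset (Fin n)) : ℝ :=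
  open Classical in
  if ∑ e, meanHits a b S T e ≤ pairExponent S T then 1
  else Real.sqrt (pairExponent S T / ∑ e, meanHits a b S T e)

/-- With exp θ − 1 ≤ θ + θ² for |θ| ≤ 1, each tail bound gives an error θμ + E/θ. The choice θ =
√(E/μ) equates the two terms, at √(μE) each; when μ ≤ E it would exceed 1 and θ = 1 suffices. -/
theorem abs_sub_le_of_tail_bounds {h μ E θ : ℝ} (hE : 0 ≤ E) (hE0 : E = 0 → μ ≤ 0)
    (hθ : θ = if μ ≤ E then 1 else Real.sqrt (E / μ)) (hμ : 0 ≤ μ)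
    (hup : θ * h ≤ (Real.exp θ - 1) * μ + E)
    (hlow : -θ * h ≤ (Real.exp (-θ) - 1) * μ + E) :
    |h - μ| ≤ 2 * E + 2 * Real.sqrt (μ * E) := by
  have hexp : ∀ x : ℝ, |x| ≤ 1 → (Real.exp x - 1) * μ ≤ x * μ + x ^ 2 * μ := by
    intro x hx
    have := (abs_le.1 (Real.abs_exp_sub_one_sub_id_le hx)).2
    nlinarith
  split_ifs at hθ with hμE
  · subst hθ
    have h1 := hexp 1 (by norm_num)
    have h2 := hexp (-1) (by norm_num)
    have h3 := Real.sqrt_nonneg (μ * E)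
    rw [abs_le]
    constructor <;> nlinarith
  · push Not at hμE
    have hEpos : 0 < E := lt_of_le_of_ne hE fun h => by have := hE0 h.symm; linarith
    have hμpos : 0 < μ := hEpos.trans hμE
    have hθpos : 0 < θ := by rw [hθ]; positivity
    have hθsq : θ ^ 2 * μ = E := by
      rw [hθ, Real.sq_sqrt (by positivity)]; field_simp
    have hθ1 : θ ≤ 1 := by
      rw [hθ]; exact Real.sqrt_le_one.2 ((div_le_one hμpos).2 hμE.le)
    have hsq : Real.sqrt (μ * E) = θ * μ := by
      rw [← hθsq, show μ * (θ ^ 2 * μ) = (θ * μ) ^ 2 by ring, Real.sqrt_sq (by positivity)]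
    have h1 := hexp θ (by rw [abs_of_pos hθpos]; exact hθ1)
    have h2 := hexp (-θ) (by rw [abs_neg, abs_of_pos hθpos]; exact hθ1)
    rw [hsq]
    have h3 : h - μ ≤ 2 * (θ * μ) := by
      refine le_of_mul_le_mul_left ?_ hθpos
      nlinarith
    have h4 : μ - h ≤ 2 * (θ * μ) := by
      refine le_of_mul_le_mul_left ?_ hθpos
      nlinarith
    rw [abs_le]
    constructor <;> linarith

theorem meanHits_eq_zero_of_pairExponent_eq_zero [Fintype V] (a b : ι → V)
    (S T : V → Finset (Fin n)) (h : pairExponent S T = 0) (e : ι) : meanHits a b S T e = 0 := by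
  have h1 := setEntropy_nonneg S
  have h2 := setEntropy_nonneg T
  have h3 : (#(S (a e)) : ℝ) ≤ setEntropy S := (card_le_fiberEntropy _).trans
    (single_le_sum (f := fun u => fiberEntropy n #(S u))
      (fun u _ => fiberEntropy_nonneg (card_fin_le (S u))) (mem_univ (a e)))
  have h4 : (#(S (a e)) : ℝ) = 0 := by
    unfold pairExponent at h
    linarith [show (0 : ℝ) ≤ #(S (a e)) by positivity]
  simp [meanHits, h4]

theorem card_subtype_le_add_add {α : Type*} [Finite α] {p q₁ q₂ q₃ : α → Prop}
    (h : ∀ x, p x → q₁ x ∨ q₂ x ∨ q₃ x) :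
    (Nat.card {x // p x} : ℝ) ≤
      Nat.card {x // q₁ x} + Nat.card {x // q₂ x} + Nat.card {x // q₃ x} := by
  classical
  have := Fintype.ofFinite α
  simp only [Nat.card_eq_fintype_card, Fintype.card_subtype]
  have hsub : ({x | p x} : Finset α) ⊆ (({x | q₁ x} : Finset α) ∪ ({x | q₂ x} : Finset α)) ∪ ({x | q₃ x} : Finset α) := by
    intro x hx
    have := h x (by simpa using hx)
    simpa [or_assoc] using this
  have hcard := (card_le_card hsub).trans ((card_union_le _ _).trans
    (Nat.add_le_add_right (card_union_le _ _) _))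
  exact_mod_cast hcard

/-- With overwhelming probability, the hits between any two sets concentrate around their mean, and
a weighted count of the hits is controlled by the exponential of the weights. -/
theorem card_not_concentrated_le [Fintype V] [Fintype ι] (a b : ι → V) (hn : 1 ≤ n)
    (hm : Fintype.card V ≤ n)
    (t : (V → Finset (Fin n)) → (V → Finset (Fin n)) → ι → ℝ) :
    (Nat.card {π : ι → Equiv.Perm (Fin n) // ¬ ∀ S T : V → Finset (Fin n),
      |∑ e, (hits a b S T π e : ℝ) - ∑ e, meanHits a b S T e| ≤ 2 * pairExponent S T +
        2 * Real.sqrt ((∑ e, meanHits a b S T e) * pairExponent S T) ∧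
      ∑ e, t S T e * hits a b S T π e ≤
        ∑ e, (Real.exp (t S T e) - 1) * meanHits a b S T e + pairExponent S T} : ℝ) ≤
      Nat.card (ι → Equiv.Perm (Fin n)) * (3 * Real.exp 2 / (n : ℝ) ^ 100) := by
  classical
  have hb := fun t => card_exists_lt_sum_mul_hits_le a b hn hm t
  have h1 := hb fun S T _ => tailParameter a b S T
  have h2 := hb fun S T _ => -tailParameter a b S T
  have h3 := hb t
  -- Three union bounds: upper tail, lower tail, and the weights `t`.
  refine (card_subtype_le_add_add ?_).trans
    ((add_le_add (add_le_add h1 h2) h3).trans (le_of_eq (by ring)))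
  · intro π hπ
    by_contra! hcon
    obtain ⟨hc1, hc2, hc3⟩ := hcon
    refine hπ fun S T => ⟨?_, hc3 S T⟩
    have hc1 := hc1 S T
    have hc2 := hc2 S T
    rw [← mul_sum, ← mul_sum] at hc1 hc2
    exact abs_sub_le_of_tail_bounds (pairExponent_nonneg S T)
      (fun h => le_of_eq (sum_eq_zero fun e _ =>
        meanHits_eq_zero_of_pairExponent_eq_zero a b S T h e))
      (by unfold tailParameter; congr) (sum_nonneg fun e _ => meanHits_nonneg a b S T e) hc1 hc2

end

/-! ### Discrepancy of a concentrated lift -/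

section

variable {V ι : Type*} {n : ℕ}

open Finset

/-- The number of vertices of a subset of the lift. -/
noncomputable def setSize [Fintype V] (S : V → Finset (Fin n)) : ℝ := ∑ u, (#(S u) : ℝ)

/-- The smaller of the numbers of end points of the pair `S, T` in the two fibres joined by `e`. -/
def minFiber (a b : ι → V) (S T : V → Finset (Fin n)) (e : ι) : ℕ := min #(S (a e)) #(T (b e))

/-- The weight of the edges over `e`; it is nonzero only if `S` or `T` has small density in its
fibre. -/
noncomputable def thinWeight (a b : ι → V) (d : ℕ) (S T : V → Finset (Fin n)) (e : ι) : ℝ :=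
  if minFiber a b S T e * d ^ 4 ≤ n then Real.log (n / minFiber a b S T e) / 2 else 0

/-- The fibres of density at least `exp (-2 ^ j)`. -/
noncomputable def denseFibers (j : ℕ) (S : V → Finset (Fin n)) (u : V) : Finset (Fin n) :=
  if (n : ℝ) ≤ #(S u) * Real.exp (2 ^ j) then S u else ∅

/-- The fibres of density more than `d⁻⁴`. -/
def thickFibers (d : ℕ) (S : V → Finset (Fin n)) (u : V) : Finset (Fin n) :=
  if n < #(S u) * d ^ 4 then S u else ∅

theorem setSize_nonneg [Fintype V] (S : V → Finset (Fin n)) : 0 ≤ setSize S :=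
  sum_nonneg fun _ _ => by positivity

theorem setSize_le_setEntropy [Fintype V] (S : V → Finset (Fin n)) :
    setSize S ≤ setEntropy S := sum_le_sum fun u _ => card_le_fiberEntropy (S u)

theorem hits_le_left (a b : ι → V) (S T : V → Finset (Fin n)) (π : ι → Equiv.Perm (Fin n))
    (e : ι) : hits a b S T π e ≤ #(S (a e)) := card_filter_le _ _

theorem hits_le_right (a b : ι → V) (S T : V → Finset (Fin n)) (π : ι → Equiv.Perm (Fin n))
    (e : ι) : hits a b S T π e ≤ #(T (b e)) :=
  card_le_card_of_injOn (π e) (fun _ hi => (mem_filter.1 hi).2) (π e).injective.injOn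

theorem minFiber_le (a b : ι → V) (S T : V → Finset (Fin n)) (e : ι) : minFiber a b S T e ≤ n :=
  (min_le_left _ _).trans (card_fin_le _)

theorem thinWeight_nonneg (a b : ι → V) (d : ℕ) (S T : V → Finset (Fin n)) (e : ι) :
    0 ≤ thinWeight a b d S T e := by
  unfold thinWeight
  split_ifs
  · have := log_div_nonneg (minFiber_le a b S T e)
    positivity
  · rfl

theorem meanHits_eq_min_mul_max (a b : ι → V) (S T : V → Finset (Fin n)) (e : ι) :
    meanHits a b S T e =
      (minFiber a b S T e : ℝ) * (max #(S (a e)) #(T (b e)) : ℕ) / n := by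
  unfold meanHits minFiber
  rw [← Nat.cast_mul, ← Nat.cast_mul, min_mul_max]

theorem max_card_le (a b : ι → V) (S T : V → Finset (Fin n)) (e : ι) :
    ((max #(S (a e)) #(T (b e)) : ℕ) : ℝ) ≤ #(S (a e)) + #(T (b e)) := by
  rw [← Nat.cast_add, Nat.cast_le]; omega

theorem meanHits_le_of_thin (a b : ι → V) {d : ℕ} (hd : 1 ≤ d) (S T : V → Finset (Fin n)) (e : ι)
    (hthin : minFiber a b S T e * d ^ 4 ≤ n) :
    meanHits a b S T e ≤ ((#(S (a e)) : ℝ) + #(T (b e))) / d := by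
  have hd' : (1 : ℝ) ≤ d := by exact_mod_cast hd
  rcases Nat.eq_zero_or_pos n with rfl | hn
  · simp only [meanHits, CharP.cast_eq_zero, div_zero]; positivity
  have hn' : (0 : ℝ) < n := by exact_mod_cast hn
  have h1 : (minFiber a b S T e : ℝ) * d ^ 4 ≤ n := by exact_mod_cast hthin
  have h2 := max_card_le a b S T e
  set M : ℝ := ((max #(S (a e)) #(T (b e)) : ℕ) : ℝ)
  set k : ℝ := (minFiber a b S T e : ℝ) with hk
  have hk0 : 0 ≤ k := by positivity
  have hM0 : 0 ≤ M := by positivity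
  have h3 : k * d ≤ n := le_trans (mul_le_mul_of_nonneg_left
    (le_self_pow₀ hd' (by norm_num)) hk0) h1
  rw [meanHits_eq_min_mul_max, div_le_div_iff₀ hn' (by linarith)]
  calc k * M * d = (k * d) * M := by ring
    _ ≤ n * (#(S (a e)) + #(T (b e))) := by gcongr
    _ = _ := by ring

/-- If k is the smaller of the two fibres, the exponential of the weight is √(n/k), which uses up
only half of the factor k/n in the mean. What remains is √(k/n) ≤ 1/d, so summing over the edges
costs no more than the sizes of the sets. -/
theorem exp_thinWeight_mul_meanHits_le (a b : ι → V) {d : ℕ} (hd : 1 ≤ d)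
    (S T : V → Finset (Fin n)) (e : ι) :
    (Real.exp (thinWeight a b d S T e) - 1) * meanHits a b S T e ≤
      ((#(S (a e)) : ℝ) + #(T (b e))) / d := by
  have hd' : (1 : ℝ) ≤ d := by exact_mod_cast hd
  have hR : 0 ≤ ((#(S (a e)) : ℝ) + #(T (b e))) / d := by positivity
  unfold thinWeight
  split_ifs with hthin
  swap
  · simpa using hR
  rcases Nat.eq_zero_or_pos (minFiber a b S T e) with h0 | hpos
  · rw [meanHits_eq_min_mul_max, h0]; simpa using hR
  have hn' : (0 : ℝ) < n := by exact_mod_cast hpos.trans_le (minFiber_le a b S T e)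
  have hk : (0 : ℝ) < minFiber a b S T e := by exact_mod_cast hpos
  have h1 : (minFiber a b S T e : ℝ) * d ^ 4 ≤ n := by exact_mod_cast hthin
  have h2 := max_card_le a b S T e
  rw [meanHits_eq_min_mul_max]
  set M : ℝ := ((max #(S (a e)) #(T (b e)) : ℕ) : ℝ)
  set k : ℝ := (minFiber a b S T e : ℝ) with hkdef
  have hM0 : 0 ≤ M := by positivity
  have hexp : Real.exp (Real.log (n / k) / 2) = Real.sqrt (n / k) := by
    rw [Real.sqrt_eq_rpow, Real.rpow_def_of_pos (by positivity)]; congr 1; ring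
  have hs : Real.sqrt (n / k) * (k / n) = Real.sqrt (k / n) := by
    have hsq : Real.sqrt (n / k) * Real.sqrt (k / n) = 1 := by
      rw [← Real.sqrt_mul (by positivity)]
      field_simp
      exact Real.sqrt_one
    calc Real.sqrt (n / k) * (k / n)
        = Real.sqrt (n / k) * (Real.sqrt (k / n) * Real.sqrt (k / n)) := by
          rw [Real.mul_self_sqrt (by positivity)]
      _ = _ := by rw [← mul_assoc, hsq, one_mul]
  have hle : Real.sqrt (k / n) ≤ 1 / d := by
    rw [Real.sqrt_le_left (by positivity), div_pow, one_pow, div_le_div_iff₀ hn' (by positivity)]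
    calc k * (d : ℝ) ^ 2 ≤ k * (d : ℝ) ^ 4 :=
          mul_le_mul_of_nonneg_left (pow_le_pow_right₀ hd' (by norm_num)) hk.le
      _ ≤ 1 * n := by linarith
  rw [hexp]
  calc (Real.sqrt (n / k) - 1) * (k * M / n) = (Real.sqrt (n / k) * (k / n)) * M - k * M / n := by
        ring
    _ ≤ (Real.sqrt (n / k) * (k / n)) * M := by
        have : 0 ≤ k * M / n := by positivity
        linarith
    _ ≤ 1 / d * (#(S (a e)) + #(T (b e))) := by rw [hs]; gcongr
    _ = _ := by ring

theorem sum_card_div_le [Fintype V] [Fintype ι] {a b : ι → V} {d : ℕ} (hd : 1 ≤ d)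
    (ha : ∀ x : V → ℝ, (∀ u, 0 ≤ x u) → ∑ e, x (a e) ≤ d * ∑ u, x u)
    (hb : ∀ x : V → ℝ, (∀ u, 0 ≤ x u) → ∑ e, x (b e) ≤ d * ∑ u, x u)
    (S T : V → Finset (Fin n)) :
    ∑ e, ((#(S (a e)) : ℝ) + #(T (b e))) / d ≤ setSize S + setSize T := by
  have hd' : (0 : ℝ) < d := by exact_mod_cast hd
  have h1 := ha (fun u => (#(S u) : ℝ)) fun _ => by positivity
  have h2 := hb (fun u => (#(T u) : ℝ)) fun _ => by positivity
  rw [← sum_div, div_le_iff₀ hd', sum_add_distrib]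
  unfold setSize
  linarith

/-! ### Thin fibres: dyadic decomposition in the logarithm of the density. -/

/-- A geometric series that starts once 2^j ≥ max(1, l) sums to at most 2 / max(1, l), which cancels
1 + l. -/
theorem sum_ite_le_two_pow_le (l : ℝ) (J : ℕ) :
    ∑ j ∈ range J, (if l ≤ 2 ^ j then (1 + l) * (1 / 2 : ℝ) ^ j else 0) ≤ 4 := by
  set c := max 1 l with hc
  have hc1 : 1 ≤ c := le_max_left _ _
  -- The sum is zero until the first admissible `j`; after that the subtracted remainder of the
  -- series makes the induction close.
  have key : ∑ j ∈ range J, (if l ≤ 2 ^ j then (1 / 2 : ℝ) ^ j else 0) = 0 ∨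
      ∑ j ∈ range J, (if l ≤ 2 ^ j then (1 / 2 : ℝ) ^ j else 0) ≤ 2 / c - 2 * (1 / 2) ^ J := by
    induction J with
    | zero => left; simp
    | succ J ih =>
      rw [sum_range_succ]
      have hpos : (0 : ℝ) < (1 / 2) ^ J := by positivity
      have hpow : (1 / 2 : ℝ) ^ (J + 1) = (1 / 2) ^ J / 2 := by rw [pow_succ]; ring
      split_ifs with h
      · right
        have hcJ : c ≤ 2 ^ J := max_le (one_le_pow₀ (by norm_num)) h
        have hinv : (1 / 2 : ℝ) ^ J ≤ 1 / c := by
          rw [one_div, inv_pow, ← one_div]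
          exact one_div_le_one_div_of_le (by linarith) hcJ
        have h2c : 2 / c = 2 * (1 / c) := by ring
        rcases ih with ih | ih
        · rw [ih, hpow]; linarith
        · rw [hpow]; linarith
      · rcases ih with ih | ih
        · left; rw [ih, add_zero]
        · right; rw [hpow]; linarith
  have h2 : ∑ j ∈ range J, (if l ≤ 2 ^ j then (1 / 2 : ℝ) ^ j else 0) ≤ 2 / c := by
    have : (0 : ℝ) ≤ 2 * (1 / 2) ^ J := by positivity
    rcases key with h | h
    · rw [h]; positivity
    · linarith
  calc _ = (1 + l) * ∑ j ∈ range J, (if l ≤ 2 ^ j then (1 / 2 : ℝ) ^ j else 0) := by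
        rw [mul_sum]; exact sum_congr rfl fun j _ => by split_ifs <;> simp
    _ ≤ (2 * c) * (2 / c) := by
        have : l ≤ c := le_max_right _ _
        gcongr
        linarith
    _ = 4 := by field_simp; norm_num

/-- A fibre of density exp(-l) has entropy (1 + l) times its size but enters only at scales 2^j ≥ l,
so the discount 2^(-j) removes the logarithm. -/
theorem sum_setEntropy_denseFibers_le [Fintype V] (S : V → Finset (Fin n)) (J : ℕ) :
    ∑ j ∈ range J, (1 / 2 : ℝ) ^ j * setEntropy (denseFibers j S) ≤ 4 * setSize S := by
  unfold setEntropy setSize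
  simp only [mul_sum]
  rw [sum_comm]
  refine sum_le_sum fun u _ => ?_
  rcases Nat.eq_zero_or_pos #(S u) with h0 | hpos
  · have : ∀ j, #(denseFibers j S u) = 0 := by
      intro j; unfold denseFibers; split_ifs <;> simp [h0]
    simp [this, fiberEntropy_zero]
  have hk : (0 : ℝ) < #(S u) := by exact_mod_cast hpos
  have hn : (0 : ℝ) < n := by exact_mod_cast hpos.trans_le (card_fin_le (S u))
  calc ∑ j ∈ range J, (1 / 2 : ℝ) ^ j * fiberEntropy n #(denseFibers j S u)
      = #(S u) * ∑ j ∈ range J, (if Real.log (n / #(S u)) ≤ 2 ^ j then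
          (1 + Real.log (n / #(S u))) * (1 / 2 : ℝ) ^ j else 0) := by
        rw [mul_sum]
        refine sum_congr rfl fun j _ => ?_
        have hiff : (n : ℝ) ≤ #(S u) * Real.exp (2 ^ j) ↔ Real.log (n / #(S u)) ≤ 2 ^ j := by
          rw [Real.log_le_iff_le_exp (by positivity), div_le_iff₀ hk, mul_comm]
        unfold denseFibers
        by_cases h : (n : ℝ) ≤ #(S u) * Real.exp (2 ^ j)
        · rw [if_pos h, if_pos (hiff.1 h), fiberEntropy]; ring
        · rw [if_neg h, if_neg (fun h' => h (hiff.2 h')), card_empty, fiberEntropy_zero]; ring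
    _ ≤ #(S u) * 4 := by
        gcongr
        exact sum_ite_le_two_pow_le _ J
    _ = _ := by ring

theorem exists_scale {l : ℝ} (hl : 1 ≤ l) {N : ℕ} (hN : l ≤ 2 ^ N) :
    ∃ j ≤ N, l ≤ 2 ^ j ∧ 1 / 2 ≤ (1 / 2 : ℝ) ^ j * l := by
  classical
  have hex : ∃ j : ℕ, l ≤ 2 ^ j := ⟨N, hN⟩
  refine ⟨Nat.find hex, Nat.find_le hN, Nat.find_spec hex, ?_⟩
  rcases h : Nat.find hex with _ | j
  · simp; linarith
  · have := Nat.find_min hex (m := j) (by omega)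
    push Not at this
    calc (1 / 2 : ℝ) = (1 / 2) ^ (j + 1) * 2 ^ j := by
          rw [pow_succ, mul_right_comm, ← mul_pow]; norm_num
      _ ≤ _ := by gcongr

/-- If the weighted counts are bounded for all pairs, then there are few edges at which one of the
two sets is thin. -/
theorem sum_thin_hits_le [Fintype V] [Fintype ι] {a b : ι → V} {d : ℕ} (hd : 3 ≤ d)
    (ha : ∀ x : V → ℝ, (∀ u, 0 ≤ x u) → ∑ e, x (a e) ≤ d * ∑ u, x u)
    (hb : ∀ x : V → ℝ, (∀ u, 0 ≤ x u) → ∑ e, x (b e) ≤ d * ∑ u, x u)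
    {π : ι → Equiv.Perm (Fin n)}
    (hπ : ∀ S T : V → Finset (Fin n), ∑ e, thinWeight a b d S T e * hits a b S T π e ≤
      ∑ e, (Real.exp (thinWeight a b d S T e) - 1) * meanHits a b S T e + pairExponent S T)
    (S T : V → Finset (Fin n)) :
    ∑ e, (if minFiber a b S T e * d ^ 4 ≤ n then (hits a b S T π e : ℝ) else 0) ≤
      1664 * (setSize S + setSize T) := by
  -- The mean term costs at most the sizes, hence at most the entropies: 104 = 103 + 1.
  have hdense : ∀ j, ∑ e, thinWeight a b d (denseFibers j S) (denseFibers j T) e *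
      hits a b (denseFibers j S) (denseFibers j T) π e ≤
      104 * (setEntropy (denseFibers j S) + setEntropy (denseFibers j T)) := by
    intro j
    have h1 := hπ (denseFibers j S) (denseFibers j T)
    have h2 := (sum_le_sum fun e (_ : e ∈ univ) => exp_thinWeight_mul_meanHits_le a b
      (by omega : 1 ≤ d) (denseFibers j S) (denseFibers j T) e).trans
      (sum_card_div_le (by omega) ha hb _ _)
    have h3 := setSize_le_setEntropy (denseFibers j S)
    have h4 := setSize_le_setEntropy (denseFibers j T)
    unfold pairExponent at h1
    linarith
  -- At the first scale with log(n/k) ≤ 2^j both ends of `e` are dense enough to be kept, and the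
  -- weight log(n/k)/2 discounted by 2^(-j) is at least 1/4. Summing over all scales then gives 4 ·
  -- 104 · 4 = 1664.
  have hedge : ∀ e, (1 / 4 : ℝ) *
      (if minFiber a b S T e * d ^ 4 ≤ n then (hits a b S T π e : ℝ) else 0) ≤
      ∑ j ∈ range (n + 1), (1 / 2 : ℝ) ^ j *
        (thinWeight a b d (denseFibers j S) (denseFibers j T) e *
          hits a b (denseFibers j S) (denseFibers j T) π e) := by
    intro e
    have hnn : ∀ j ∈ range (n + 1), 0 ≤ (1 / 2 : ℝ) ^ j *
        (thinWeight a b d (denseFibers j S) (denseFibers j T) e *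
          hits a b (denseFibers j S) (denseFibers j T) π e) := fun j _ => by
      have := thinWeight_nonneg a b d (denseFibers j S) (denseFibers j T) e
      positivity
    split_ifs with hthin
    swap
    · simpa using sum_nonneg hnn
    rcases Nat.eq_zero_or_pos (minFiber a b S T e) with h0 | hpos
    · have : hits a b S T π e = 0 := by
        have h1 := hits_le_left a b S T π e
        have h2 := hits_le_right a b S T π e
        unfold minFiber at h0
        omega
      rw [this]
      simpa using sum_nonneg hnn
    have hk : (0 : ℝ) < minFiber a b S T e := by exact_mod_cast hpos
    have hk1 : (1 : ℝ) ≤ minFiber a b S T e := by exact_mod_cast hpos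
    have hn : (0 : ℝ) < n := by exact_mod_cast hpos.trans_le (minFiber_le a b S T e)
    have hl1 : 1 ≤ Real.log (n / minFiber a b S T e) := by
      rw [Real.le_log_iff_exp_le (by positivity), le_div_iff₀ hk]
      have h3 : (3 : ℝ) ≤ (d : ℝ) ^ 4 := by
        have : (3 : ℝ) ≤ d := by exact_mod_cast hd
        calc (3 : ℝ) ≤ d := this
          _ ≤ (d : ℝ) ^ 4 := le_self_pow₀ (by linarith) (by norm_num)
      have h4 : (minFiber a b S T e : ℝ) * d ^ 4 ≤ n := by exact_mod_cast hthin
      nlinarith [Real.exp_one_lt_d9]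
    have hlN : Real.log (n / minFiber a b S T e) ≤ 2 ^ n := by
      have h1 := Real.log_le_sub_one_of_pos (div_pos hn hk)
      have h2 : (n : ℝ) / minFiber a b S T e ≤ n := div_le_self hn.le hk1
      have h3 : (n : ℝ) ≤ 2 ^ n := by exact_mod_cast (Nat.lt_two_pow_self (n := n)).le
      linarith
    obtain ⟨j, hjn, hj, hj2⟩ := exists_scale hl1 hlN
    have hdens : (n : ℝ) ≤ minFiber a b S T e * Real.exp (2 ^ j) := by
      rw [Real.log_le_iff_le_exp (by positivity), div_le_iff₀ hk] at hj
      linarith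
    have hS : denseFibers j S (a e) = S (a e) := by
      refine if_pos (hdens.trans ?_)
      gcongr
      exact min_le_left _ _
    have hT : denseFibers j T (b e) = T (b e) := by
      refine if_pos (hdens.trans ?_)
      gcongr
      exact min_le_right _ _
    have hmin : minFiber a b (denseFibers j S) (denseFibers j T) e = minFiber a b S T e := by
      unfold minFiber; rw [hS, hT]
    have hhits : hits a b (denseFibers j S) (denseFibers j T) π e = hits a b S T π e := by
      unfold hits; rw [hS, hT]
    refine le_trans ?_ (single_le_sum hnn (mem_range.2 (Nat.lt_succ_of_le hjn)))
    rw [thinWeight, hmin, hhits, if_pos hthin]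
    have hh : (0 : ℝ) ≤ hits a b S T π e := by positivity
    nlinarith
  have hsum := sum_le_sum fun e (_ : e ∈ univ) => hedge e
  rw [← mul_sum, sum_comm] at hsum
  have h2 : ∑ j ∈ range (n + 1), ∑ e, (1 / 2 : ℝ) ^ j *
        (thinWeight a b d (denseFibers j S) (denseFibers j T) e *
          hits a b (denseFibers j S) (denseFibers j T) π e) ≤
      104 * (∑ j ∈ range (n + 1), (1 / 2 : ℝ) ^ j * setEntropy (denseFibers j S) +
        ∑ j ∈ range (n + 1), (1 / 2 : ℝ) ^ j * setEntropy (denseFibers j T)) := by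
    rw [← sum_add_distrib, mul_sum]
    refine sum_le_sum fun j _ => ?_
    rw [← mul_sum]
    have := mul_le_mul_of_nonneg_left (hdense j) (show (0 : ℝ) ≤ (1 / 2) ^ j by positivity)
    linarith
  have h3 := sum_setEntropy_denseFibers_le S (n + 1)
  have h4 := sum_setEntropy_denseFibers_le T (n + 1)
  linarith

/-! ### Thick fibres and the discrepancy bound. -/

theorem thickFibers_card_le (d : ℕ) (S : V → Finset (Fin n)) (u : V) :
    #(thickFibers d S u) ≤ #(S u) := by
  unfold thickFibers; split_ifs <;> simp

theorem setSize_thickFibers_le [Fintype V] (d : ℕ) (S : V → Finset (Fin n)) :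
    setSize (thickFibers d S) ≤ setSize S :=
  sum_le_sum fun u _ => by exact_mod_cast thickFibers_card_le d S u

/-- On a thick fibre log(n/k) ≤ 4 log d, and the remaining 1 is at most log d since d ≥ 3 > e. -/
theorem setEntropy_thickFibers_le [Fintype V] {d : ℕ} (hd : 3 ≤ d) (S : V → Finset (Fin n)) :
    setEntropy (thickFibers d S) ≤ 5 * Real.log d * setSize S := by
  have hd' : (3 : ℝ) ≤ d := by exact_mod_cast hd
  have hlog : 1 ≤ Real.log d := by
    rw [Real.le_log_iff_exp_le (by linarith)]
    linarith [Real.exp_one_lt_d9]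
  unfold setEntropy setSize
  rw [mul_sum]
  refine sum_le_sum fun u _ => ?_
  unfold thickFibers
  split_ifs with h
  · have hpos : 0 < #(S u) := by
      by_contra h0
      have : #(S u) = 0 := by omega
      rw [this] at h; omega
    have hk : (0 : ℝ) < #(S u) := by exact_mod_cast hpos
    have hn : (0 : ℝ) < n := by exact_mod_cast hpos.trans_le (card_fin_le (S u))
    have h1 : (n : ℝ) ≤ #(S u) * (d : ℝ) ^ 4 := by exact_mod_cast h.le
    have h2 : Real.log (n / #(S u)) ≤ 4 * Real.log d := by
      rw [show (4 : ℝ) * Real.log d = Real.log ((d : ℝ) ^ 4) by rw [Real.log_pow]; norm_num]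
      refine Real.log_le_log (by positivity) ?_
      rw [div_le_iff₀ hk]; linarith
    unfold fiberEntropy
    nlinarith
  · simp only [card_empty, fiberEntropy_zero]; positivity

theorem setEntropy_le [Fintype V] (S : V → Finset (Fin n)) :
    setEntropy S ≤ n * Fintype.card V := by
  calc setEntropy S ≤ ∑ _u : V, (n : ℝ) := sum_le_sum fun u _ => fiberEntropy_le (card_fin_le (S u))
    _ = _ := by rw [sum_const, card_univ, nsmul_eq_mul, mul_comm]

theorem sqrt_sum_sq_card_le [Fintype V] (S : V → Finset (Fin n)) :
    Real.sqrt (∑ u, (#(S u) : ℝ) ^ 2) ≤ Real.sqrt n * Real.sqrt (setSize S) := by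
  rw [← Real.sqrt_mul (by positivity)]
  refine Real.sqrt_le_sqrt ?_
  unfold setSize
  rw [mul_sum]
  refine sum_le_sum fun u _ => ?_
  have : (#(S u) : ℝ) ≤ n := by exact_mod_cast card_fin_le (S u)
  nlinarith [show (0 : ℝ) ≤ #(S u) by positivity]

/-- The mixing inequality of the base graph is applied to the vectors of fibre sizes. Sizes are at
most `n`, so the product of the ℓ² norms is at most n√(|S||T|), and this `n` cancels the one in the
mean. -/
theorem sum_meanHits_le [Fintype V] [Fintype ι] {a b : ι → V} {d : ℕ} {α : ℝ} (hα : 0 ≤ α)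
    (hmix : ∀ x y : V → ℝ, (∀ u, 0 ≤ x u) → (∀ u, 0 ≤ y u) → ∑ e, x (a e) * y (b e) ≤
      d / Fintype.card V * ((∑ u, x u) * ∑ u, y u) +
        α * (Real.sqrt (∑ u, x u ^ 2) * Real.sqrt (∑ u, y u ^ 2)))
    (hn : 1 ≤ n) (S T : V → Finset (Fin n)) :
    ∑ e, meanHits a b S T e ≤ d * (setSize S * setSize T) / (n * Fintype.card V) +
      α * Real.sqrt (setSize S * setSize T) := by
  have hn' : (0 : ℝ) < n := by exact_mod_cast hn
  have h1 := hmix (fun u => (#(S u) : ℝ)) (fun u => (#(T u) : ℝ)) (fun _ => by positivity)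
    fun _ => by positivity
  have h2 : Real.sqrt (∑ u, (#(S u) : ℝ) ^ 2) * Real.sqrt (∑ u, (#(T u) : ℝ) ^ 2) ≤
      n * Real.sqrt (setSize S * setSize T) := by
    calc _ ≤ (Real.sqrt n * Real.sqrt (setSize S)) * (Real.sqrt n * Real.sqrt (setSize T)) := by
          gcongr
          · exact sqrt_sum_sq_card_le S
          · exact sqrt_sum_sq_card_le T
      _ = (Real.sqrt n * Real.sqrt n) * (Real.sqrt (setSize S) * Real.sqrt (setSize T)) := by ring
      _ = _ := by
          rw [Real.mul_self_sqrt hn'.le, ← Real.sqrt_mul (setSize_nonneg S)]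
  unfold meanHits
  rw [← sum_div, div_le_iff₀ hn']
  refine h1.trans ?_
  have h3 := mul_le_mul_of_nonneg_left h2 hα
  have h4 : d * (setSize S * setSize T) / (n * Fintype.card V) * n =
      d / Fintype.card V * (setSize S * setSize T) := by
    field_simp
  rw [add_mul, h4]
  unfold setSize at h3 ⊢
  linarith

/-- The discrepancy bound for a concentrated lift. -/
theorem abs_discrepancy_le [Fintype V] [Fintype ι] {a b : ι → V} {d : ℕ} {α : ℝ} (hd : 3 ≤ d)
    (hα : Real.sqrt d ≤ α)
    (ha : ∀ x : V → ℝ, (∀ u, 0 ≤ x u) → ∑ e, x (a e) ≤ d * ∑ u, x u)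
    (hb : ∀ x : V → ℝ, (∀ u, 0 ≤ x u) → ∑ e, x (b e) ≤ d * ∑ u, x u)
    (hmix : ∀ x y : V → ℝ, (∀ u, 0 ≤ x u) → (∀ u, 0 ≤ y u) → ∑ e, x (a e) * y (b e) ≤
      d / Fintype.card V * ((∑ u, x u) * ∑ u, y u) +
        α * (Real.sqrt (∑ u, x u ^ 2) * Real.sqrt (∑ u, y u ^ 2)))
    (hn : 1 ≤ n) {π : ι → Equiv.Perm (Fin n)}
    (hπ : ∀ S T : V → Finset (Fin n),
      |∑ e, (hits a b S T π e : ℝ) - ∑ e, meanHits a b S T e| ≤ 2 * pairExponent S T +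
        2 * Real.sqrt ((∑ e, meanHits a b S T e) * pairExponent S T) ∧
      ∑ e, thinWeight a b d S T e * hits a b S T π e ≤
        ∑ e, (Real.exp (thinWeight a b d S T e) - 1) * meanHits a b S T e + pairExponent S T)
    (S T : V → Finset (Fin n)) :
    |∑ e, (hits a b S T π e : ℝ) - ∑ e, meanHits a b S T e| ≤
      32 * α * Real.sqrt (setSize S * setSize T) +
        4000 * Real.log d * (setSize S + setSize T) := by
  have hd' : (3 : ℝ) ≤ d := by exact_mod_cast hd
  have hlog : 1 ≤ Real.log d := by
    rw [Real.le_log_iff_exp_le (by linarith)]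
    linarith [Real.exp_one_lt_d9]
  have hα0 : 0 ≤ α := (Real.sqrt_nonneg _).trans hα
  have hn' : (0 : ℝ) < n := by exact_mod_cast hn
  set S' := thickFibers d S with hS'
  set T' := thickFibers d T with hT'
  have hs0 := setSize_nonneg S
  have ht0 := setSize_nonneg T
  have hs0' := setSize_nonneg S'
  have ht0' := setSize_nonneg T'
  have hthick : ∀ e, (hits a b S' T' π e : ℝ) =
        (if minFiber a b S T e * d ^ 4 ≤ n then 0 else (hits a b S T π e : ℝ)) ∧
      meanHits a b S' T' e =
        (if minFiber a b S T e * d ^ 4 ≤ n then 0 else meanHits a b S T e) := by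
    intro e
    by_cases h : minFiber a b S T e * d ^ 4 ≤ n
    · rw [if_pos h, if_pos h]
      have : #(S (a e)) * d ^ 4 ≤ n ∨ #(T (b e)) * d ^ 4 ≤ n := by
        unfold minFiber at h
        rcases min_choice #(S (a e)) #(T (b e)) with hm | hm <;> rw [hm] at h
        · exact Or.inl h
        · exact Or.inr h
      rcases this with h1 | h1
      · have : S' (a e) = ∅ := if_neg (by omega)
        simp [hits, meanHits, this]
      · have : T' (b e) = ∅ := if_neg (by omega)
        simp [hits, meanHits, this]
    · rw [if_neg h, if_neg h]
      push Not at h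
      have h1 : S' (a e) = S (a e) := if_pos (h.trans_le (by
        gcongr; exact min_le_left _ _))
      have h2 : T' (b e) = T (b e) := if_pos (h.trans_le (by
        gcongr; exact min_le_right _ _))
      simp [hits, meanHits, h1, h2]
  have hsplit1 : ∑ e, (hits a b S T π e : ℝ) = ∑ e, (hits a b S' T' π e : ℝ) +
      ∑ e, (if minFiber a b S T e * d ^ 4 ≤ n then (hits a b S T π e : ℝ) else 0) := by
    rw [← sum_add_distrib]
    refine sum_congr rfl fun e _ => ?_
    rw [(hthick e).1]; split_ifs <;> simp
  have hsplit2 : ∑ e, meanHits a b S T e = ∑ e, meanHits a b S' T' e +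
      ∑ e, (if minFiber a b S T e * d ^ 4 ≤ n then meanHits a b S T e else 0) := by
    rw [← sum_add_distrib]
    refine sum_congr rfl fun e _ => ?_
    rw [(hthick e).2]; split_ifs <;> simp
  have hthin1 := sum_thin_hits_le hd ha hb (fun S T => (hπ S T).2) S T
  have hthin1' : 0 ≤ ∑ e, (if minFiber a b S T e * d ^ 4 ≤ n then
      (hits a b S T π e : ℝ) else 0) := sum_nonneg fun e _ => by split_ifs <;> positivity
  have hthin2 : ∑ e, (if minFiber a b S T e * d ^ 4 ≤ n then meanHits a b S T e else 0) ≤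
      setSize S + setSize T := by
    refine le_trans (sum_le_sum fun e _ => ?_) (sum_card_div_le (by omega) ha hb S T)
    split_ifs with h
    · exact meanHits_le_of_thin a b (by omega) S T e h
    · positivity
  have hthin2' : 0 ≤ ∑ e, (if minFiber a b S T e * d ^ 4 ≤ n then
      meanHits a b S T e else 0) := sum_nonneg fun e _ => by
    split_ifs
    · exact meanHits_nonneg a b S T e
    · rfl
  set E := pairExponent S' T' with hE
  have hE0 : 0 ≤ E := pairExponent_nonneg S' T'
  have hE1 : E ≤ 515 * Real.log d * (setSize S + setSize T) := by
    have h1 := setEntropy_thickFibers_le hd S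
    have h2 := setEntropy_thickFibers_le hd T
    rw [hE, pairExponent]
    linarith
  -- A second, volume bound on the exponent: its factor nm cancels the denominator of the main term
  -- of the mean in `hsqrt`, leaving 206 d R² ≤ (16αR)².
  have hE2 : E ≤ 206 * (n * Fintype.card V) := by
    have h1 := setEntropy_le S'
    have h2 := setEntropy_le T'
    rw [hE, pairExponent]
    linarith
  set R := Real.sqrt (setSize S * setSize T) with hR
  have hR0 : 0 ≤ R := Real.sqrt_nonneg _
  have hRsq : R ^ 2 = setSize S * setSize T := Real.sq_sqrt (by positivity)
  have hST : setSize S' * setSize T' ≤ setSize S * setSize T :=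
    mul_le_mul (setSize_thickFibers_le d S) (setSize_thickFibers_le d T) ht0' hs0
  have hmean : ∑ e, meanHits a b S' T' e ≤ d * R ^ 2 / (n * Fintype.card V) + α * R := by
    refine (sum_meanHits_le hα0 hmix hn S' T').trans ?_
    rw [hRsq]
    gcongr
    exact Real.sqrt_le_sqrt hST
  have hdα : (d : ℝ) ≤ α ^ 2 := by
    have := Real.sq_sqrt (show (0 : ℝ) ≤ d by positivity)
    nlinarith [Real.sqrt_nonneg (d : ℝ)]
  have hsqrt : Real.sqrt ((∑ e, meanHits a b S' T' e) * E) ≤ 16 * α * R + E := by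
    rw [Real.sqrt_le_left (by positivity)]
    have h1 : d * R ^ 2 / (n * Fintype.card V) * E ≤ 206 * (d * R ^ 2) := by
      rcases (Nat.zero_le (Fintype.card V)).eq_or_lt with h0 | hpos
      · rw [← h0]; simp only [CharP.cast_eq_zero, mul_zero, div_zero, zero_mul]; positivity
      · have hm : (0 : ℝ) < Fintype.card V := by exact_mod_cast hpos
        rw [div_mul_eq_mul_div, div_le_iff₀ (by positivity)]
        have := mul_le_mul_of_nonneg_left hE2 (show 0 ≤ d * R ^ 2 by positivity)
        linarith
    have h2 : (d : ℝ) * R ^ 2 ≤ (α * R) ^ 2 := by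
      rw [mul_pow]; gcongr
    have h3 : 0 ≤ α * R := by positivity
    calc (∑ e, meanHits a b S' T' e) * E ≤
          (d * R ^ 2 / (n * Fintype.card V) + α * R) * E := by gcongr
      _ ≤ 206 * (α * R) ^ 2 + α * R * E := by rw [add_mul]; linarith
      _ ≤ (16 * α * R + E) ^ 2 := by nlinarith [mul_nonneg h3 hE0, sq_nonneg (α * R)]
  have hmain := (hπ S' T').1
  rw [← hE] at hmain
  have hlin : setSize S + setSize T ≤ Real.log d * (setSize S + setSize T) :=
    le_mul_of_one_le_left (by positivity) hlog
  -- The thick part contributes 4E + 32αR and the thin part at most 1664(|S| + |T|); 4 · 515 + 1664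
  -- ≤ 4000.
  rw [abs_le] at hmain ⊢
  rw [hsplit1, hsplit2]
  constructor <;> linarith [hmain.1, hmain.2]

/-- The degree alone gives this, for every lift. It serves pairs of digits far apart, where the
discrepancy bound loses too much. -/
theorem abs_sub_le_mul_setSize [Fintype V] [Fintype ι] {a b : ι → V} {d : ℕ}
    (ha : ∀ x : V → ℝ, (∀ u, 0 ≤ x u) → ∑ e, x (a e) ≤ d * ∑ u, x u)
    (hb : ∀ x : V → ℝ, (∀ u, 0 ≤ x u) → ∑ e, x (b e) ≤ d * ∑ u, x u)
    (π : ι → Equiv.Perm (Fin n)) (S T : V → Finset (Fin n)) :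
    |∑ e, (hits a b S T π e : ℝ) - ∑ e, meanHits a b S T e| ≤
      d * min (setSize S) (setSize T) := by
  have h0 : 0 ≤ ∑ e, (hits a b S T π e : ℝ) := sum_nonneg fun _ _ => by positivity
  have h0' : 0 ≤ ∑ e, meanHits a b S T e := sum_nonneg fun e _ => meanHits_nonneg a b S T e
  have hm : ∀ x y : ℕ, y ≤ n → (x : ℝ) * y / n ≤ x := by
    intro x y hy
    rw [mul_div_assoc]
    exact mul_le_of_le_one_right (by positivity) (div_le_one_of_le₀ (by exact_mod_cast hy)
      (by positivity))
  have h1 : ∑ e, (hits a b S T π e : ℝ) ≤ d * setSize S :=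
    (sum_le_sum fun e _ => by exact_mod_cast hits_le_left a b S T π e).trans
      (ha (fun u => (#(S u) : ℝ)) fun _ => by positivity)
  have h2 : ∑ e, (hits a b S T π e : ℝ) ≤ d * setSize T :=
    (sum_le_sum fun e _ => by exact_mod_cast hits_le_right a b S T π e).trans
      (hb (fun u => (#(T u) : ℝ)) fun _ => by positivity)
  have h3 : ∑ e, meanHits a b S T e ≤ d * setSize S :=
    (sum_le_sum fun e _ => hm _ _ (card_fin_le _)).trans
      (ha (fun u => (#(S u) : ℝ)) fun _ => by positivity)
  have h4 : ∑ e, meanHits a b S T e ≤ d * setSize T :=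
    (sum_le_sum fun e _ => by
      unfold meanHits; rw [mul_comm]; exact hm _ _ (card_fin_le _)).trans
      (hb (fun u => (#(T u) : ℝ)) fun _ => by positivity)
  rw [abs_le]
  rcases min_choice (setSize S) (setSize T) with h | h <;> rw [h] <;> constructor <;> linarith

end

/-! ### From discrepancy to the quadratic form -/

section

open Finset

/-- Each distance from `k` occurs at most once on either side of `k`. -/
theorem sum_natDist_le {w : ℕ → ℝ} (hw : ∀ r, 0 ≤ w r) (K k : ℕ) (hk : k < K) :
    ∑ l ∈ range K, w (Nat.dist k l) ≤ 2 * ∑ r ∈ range K, w r := by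
  have key : ∀ F : Finset ℕ, F ⊆ range K → Set.InjOn (Nat.dist k) F →
      ∑ l ∈ F, w (Nat.dist k l) ≤ ∑ r ∈ range K, w r := by
    intro F hF hinj
    rw [← sum_image (f := w) (g := Nat.dist k) hinj]
    refine sum_le_sum_of_subset_of_nonneg ?_ fun r _ _ => hw r
    intro r hr
    obtain ⟨l, hl, rfl⟩ := mem_image.1 hr
    have := mem_range.1 (hF hl)
    rw [mem_range, Nat.dist]
    omega
  rw [← sum_filter_add_sum_filter_not (range K) (fun l => l ≤ k), two_mul]
  refine add_le_add (key _ (filter_subset _ _) ?_) (key _ (filter_subset _ _) ?_)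
  · intro x hx y hy hxy
    simp only [coe_filter, Set.mem_ofPred_eq, Nat.dist] at hx hy hxy
    omega
  · intro x hx y hy hxy
    simp only [coe_filter, Set.mem_ofPred_eq, Nat.dist] at hx hy hxy
    omega

theorem sum_abs_le_of_natDist {w p q : ℕ → ℝ} {D : ℕ → ℕ → ℝ} (K : ℕ) (hw : ∀ r, 0 ≤ w r)
    (hp : ∀ k, 0 ≤ p k) (hq : ∀ l, 0 ≤ q l)
    (hD : ∀ k l, |D k l| ≤ w (Nat.dist k l) * (p k + q l)) :
    |∑ k ∈ range K, ∑ l ∈ range K, D k l| ≤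
      2 * (∑ r ∈ range K, w r) * (∑ k ∈ range K, p k + ∑ l ∈ range K, q l) := by
  calc |∑ k ∈ range K, ∑ l ∈ range K, D k l|
      ≤ ∑ k ∈ range K, ∑ l ∈ range K, w (Nat.dist k l) * (p k + q l) :=
        (abs_sum_le_sum_abs _ _).trans (sum_le_sum fun k _ =>
          (abs_sum_le_sum_abs _ _).trans (sum_le_sum fun l _ => hD k l))
    _ = ∑ k ∈ range K, p k * ∑ l ∈ range K, w (Nat.dist k l) +
        ∑ l ∈ range K, q l * ∑ k ∈ range K, w (Nat.dist l k) := by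
        simp only [mul_add, sum_add_distrib, mul_sum]
        congr 1
        · exact sum_congr rfl fun k _ => sum_congr rfl fun l _ => mul_comm _ _
        · rw [sum_comm]
          exact sum_congr rfl fun k _ => sum_congr rfl fun l _ => by rw [mul_comm, Nat.dist_comm]
    _ ≤ ∑ k ∈ range K, p k * (2 * ∑ r ∈ range K, w r) +
        ∑ l ∈ range K, q l * (2 * ∑ r ∈ range K, w r) := by
        refine add_le_add (sum_le_sum fun k hk => ?_) (sum_le_sum fun k hk => ?_)
        · exact mul_le_mul_of_nonneg_left (sum_natDist_le hw K k (mem_range.1 hk)) (hp k)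
        · exact mul_le_mul_of_nonneg_left (sum_natDist_le hw K k (mem_range.1 hk)) (hq k)
    _ = _ := by rw [← sum_mul, ← sum_mul]; ring

/-- The bound for the contribution of two dyadic scales at distance `r`. -/
noncomputable def scaleWeight (A B : ℝ) (d : ℝ) (h r : ℕ) : ℝ :=
  if r ≤ h then A + B * 2 ^ r else d * (1 / 2) ^ r

theorem scaleWeight_nonneg {A B d : ℝ} (hA : 0 ≤ A) (hB : 0 ≤ B) (hd : 0 ≤ d) (h r : ℕ) :
    0 ≤ scaleWeight A B d h r := by
  unfold scaleWeight; split_ifs <;> positivity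

theorem sum_ite_half_pow_le (h K : ℕ) :
    ∑ r ∈ range K, (if r ≤ h then 0 else (1 / 2 : ℝ) ^ r) ≤ (1 / 2) ^ h := by
  have key : ∑ r ∈ range K, (if r ≤ h then 0 else (1 / 2 : ℝ) ^ r) = 0 ∨
      ∑ r ∈ range K, (if r ≤ h then 0 else (1 / 2 : ℝ) ^ r) ≤ (1 / 2) ^ h - 2 * (1 / 2) ^ K := by
    induction K with
    | zero => left; simp
    | succ K ih =>
      rw [sum_range_succ]
      have hpos : (0 : ℝ) < (1 / 2) ^ K := by positivity
      have hpow : (1 / 2 : ℝ) ^ (K + 1) = (1 / 2) ^ K / 2 := by rw [pow_succ]; ring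
      split_ifs with hK
      · rcases ih with ih | ih
        · left; rw [ih, add_zero]
        · right; rw [hpow]; linarith
      · right
        have hle : (1 / 2 : ℝ) ^ K ≤ (1 / 2) ^ (h + 1) :=
          pow_le_pow_of_le_one (by norm_num) (by norm_num) (by omega)
        have hpow' : (1 / 2 : ℝ) ^ (h + 1) = (1 / 2) ^ h / 2 := by rw [pow_succ]; ring
        rcases ih with ih | ih
        · rw [ih, hpow]; linarith
        · rw [hpow]; linarith
  have h1 : (0 : ℝ) < (1 / 2) ^ K := by positivity
  have h2 : (0 : ℝ) < (1 / 2) ^ h := by positivity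
  rcases key with h3 | h3 <;> linarith

theorem sum_scaleWeight_le {A B d : ℝ} (hA : 0 ≤ A) (hB : 0 ≤ B) (hd : 0 ≤ d) (h K : ℕ) :
    ∑ r ∈ range K, scaleWeight A B d h r ≤ (h + 1) * A + B * 2 ^ (h + 1) + d * (1 / 2) ^ h := by
  have h1 : ∑ r ∈ range K, scaleWeight A B d h r =
      ∑ r ∈ range K, (if r ≤ h then A + B * 2 ^ r else 0) +
        d * ∑ r ∈ range K, (if r ≤ h then 0 else (1 / 2 : ℝ) ^ r) := by
    rw [mul_sum, ← sum_add_distrib]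
    refine sum_congr rfl fun r _ => ?_
    unfold scaleWeight; split_ifs <;> simp
  have h2 : ∑ r ∈ range K, (if r ≤ h then A + B * 2 ^ r else 0) ≤
      ∑ r ∈ range (h + 1), (A + B * 2 ^ r) := by
    rw [← sum_filter]
    refine sum_le_sum_of_subset_of_nonneg ?_ fun r _ _ => by positivity
    intro r hr
    have := (mem_filter.1 hr).2
    rw [mem_range]; omega
  have h3 : ∑ r ∈ range (h + 1), (A + B * 2 ^ r) = (h + 1) * A + B * (2 ^ (h + 1) - 1) := by
    rw [sum_add_distrib, sum_const, card_range, nsmul_eq_mul, ← mul_sum, geom_sum_eq (by norm_num)]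
    push_cast; norm_num
  have h4 := mul_le_mul_of_nonneg_left (sum_ite_half_pow_le h K) hd
  rw [h1]
  linarith

/-- Let r = k − l ≥ 0 and divide by 4^l. Nearby scales use 2^r √(st) ≤ 4^r s + t, losing 2^r only on
the linear term. Distant scales use |D| ≤ ds, and 2^r s is 2^(-r) times the available 4^r s. -/
theorem abs_two_pow_mul_le_scaleWeight {A B d s t D : ℝ} (hA : 0 ≤ A) (hB : 0 ≤ B) (hd : 0 ≤ d)
    (hs : 0 ≤ s) (ht : 0 ≤ t) (hD1 : |D| ≤ A * Real.sqrt (s * t) + B * (s + t))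
    (hD2 : |D| ≤ d * min s t) (h k l : ℕ) :
    |2 ^ (k + l) * D| ≤ scaleWeight A B d h (Nat.dist k l) * (4 ^ k * s + 4 ^ l * t) := by
  wlog hkl : l ≤ k generalizing k l s t with H
  · have := H ht hs (by rwa [mul_comm t s, add_comm t s]) (by rwa [min_comm]) l k (by omega)
    rwa [add_comm l k, Nat.dist_comm, add_comm (4 ^ l * t)] at this
  obtain ⟨r, rfl⟩ := Nat.exists_eq_add_of_le hkl
  have hr : Nat.dist (l + r) l = r := by rw [Nat.dist]; omega
  have h4l : (4 : ℝ) ^ l = 2 ^ l * 2 ^ l := by rw [← mul_pow]; norm_num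
  have h4 : (4 : ℝ) ^ (l + r) = 2 ^ l * 2 ^ l * (2 ^ r * 2 ^ r) := by
    rw [pow_add, h4l, ← mul_pow (2 : ℝ) 2 r]; norm_num
  have h2 : (2 : ℝ) ^ (l + r + l) = 2 ^ l * 2 ^ l * 2 ^ r := by rw [pow_add, pow_add]; ring
  have hr1 : (1 : ℝ) ≤ 2 ^ r := one_le_pow₀ (by norm_num)
  rw [hr, h2, h4, h4l, abs_mul, abs_of_pos (by positivity)]
  set c : ℝ := 2 ^ l * 2 ^ l with hc
  have hc0 : 0 < c := by positivity
  set x : ℝ := 2 ^ r with hx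
  unfold scaleWeight
  split_ifs with hrh
  · have hsqrt : x * Real.sqrt (s * t) ≤ x * x * s + t := by
      have hle : Real.sqrt (s * t) * x ≤ x * x * s + t := by
        rw [← Real.sqrt_sq (show (0 : ℝ) ≤ x by positivity), ← Real.sqrt_mul (by positivity),
          Real.sqrt_sq (show (0 : ℝ) ≤ x by positivity), Real.sqrt_le_left (by positivity)]
        nlinarith [mul_nonneg hs ht, sq_nonneg (x * x * s - t), mul_nonneg (sq_nonneg x)
          (mul_nonneg hs ht)]
      linarith
    have hlin : x * (s + t) ≤ x * (x * x * s + t) := by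
      have : s ≤ x * x * s := le_mul_of_one_le_left hs (one_le_mul_of_one_le_of_one_le hr1 hr1)
      gcongr
    calc c * x * |D| ≤ c * x * (A * Real.sqrt (s * t) + B * (s + t)) := by gcongr
      _ = c * (A * (x * Real.sqrt (s * t)) + B * (x * (s + t))) := by ring
      _ ≤ c * (A * (x * x * s + t) + B * (x * (x * x * s + t))) := by gcongr
      _ = _ := by rw [hx]; ring
  · have hmin : |D| ≤ d * s := hD2.trans (mul_le_mul_of_nonneg_left (min_le_left _ _) hd)
    have hinv : (1 / 2 : ℝ) ^ r * x = 1 := by rw [hx, ← mul_pow]; norm_num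
    calc c * x * |D| ≤ c * x * (d * s) := by gcongr
      _ = d * (1 / 2) ^ r * (c * (x * x) * s) := by linear_combination (-(c * x * d * s)) * hinv
      _ ≤ d * (1 / 2) ^ r * (c * (x * x) * s + c * t) := by
          gcongr
          have : 0 ≤ c * t := by positivity
          linarith

/-! ### Binary digits and the deviation form. -/

theorem sum_testBit (K : ℕ) : ∀ x : ℕ, x < 2 ^ K →
    ∑ k ∈ range K, (if x.testBit k then 2 ^ k else 0) = x := by
  induction K with
  | zero => intro x hx; simp at hx; simp [hx]
  | succ K ih =>
    intro x hx
    rw [sum_range_succ', Nat.testBit_zero]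
    have h1 := ih (x / 2) (by rw [pow_succ] at hx; omega)
    have h2 : ∑ k ∈ range K, (if x.testBit (k + 1) then 2 ^ (k + 1) else 0) = 2 * (x / 2) := by
      rw [← h1, mul_sum]
      refine sum_congr rfl fun k _ => ?_
      rw [Nat.testBit_succ]
      split_ifs
      · rw [pow_succ]; ring
      · rfl
    rw [h2]
    by_cases h : x % 2 = 1
    · simp [h]; omega
    · simp [h]; omega

/-- Each digit present satisfies 2^k ≤ x, so the sum of 4^k is at most x times the sum of 2^k. Thus
the level sets, weighted by 4^k, cost no more than the squared norm. -/
theorem sum_testBit_sq_le {K x : ℕ} (hx : x < 2 ^ K) :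
    ∑ k ∈ range K, (if x.testBit k then 4 ^ k else 0) ≤ x ^ 2 := by
  have hsum := sum_testBit K x hx
  calc ∑ k ∈ range K, (if x.testBit k then 4 ^ k else 0)
      ≤ ∑ k ∈ range K, (if x.testBit k then 2 ^ k else 0) * x := by
        refine sum_le_sum fun k hk => ?_
        split_ifs with hb
        · have h1 := single_le_sum (f := fun k => if x.testBit k then 2 ^ k else 0)
            (fun _ _ => Nat.zero_le _) hk
          rw [hsum] at h1
          simp only [hb, if_true] at h1
          calc 4 ^ k = 2 ^ k * 2 ^ k := by rw [← mul_pow]; norm_num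
            _ ≤ _ := Nat.mul_le_mul_left _ h1
        · simp
    _ = x ^ 2 := by rw [← sum_mul, hsum, sq]

variable {V ι : Type*} {n : ℕ}

/-- The bilinear form of the lift minus its expectation, restricted to one direction of the
edges. -/
noncomputable def deviationForm [Fintype ι] (a b : ι → V) (π : ι → Equiv.Perm (Fin n))
    (f g : Fin n × V → ℝ) : ℝ :=
  ∑ e, (∑ i, f (i, a e) * g (π e i, b e) - (∑ i, f (i, a e)) * (∑ i, g (i, b e)) / n)

/-- The indicator function of a subset of the lift. -/
def setIndicator (S : V → Finset (Fin n)) (x : Fin n × V) : ℝ := if x.1 ∈ S x.2 then 1 else 0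

theorem deviationForm_setIndicator [Fintype ι] (a b : ι → V) (π : ι → Equiv.Perm (Fin n))
    (S T : V → Finset (Fin n)) :
    deviationForm a b π (setIndicator S) (setIndicator T) =
      ∑ e, (hits a b S T π e : ℝ) - ∑ e, meanHits a b S T e := by
  unfold deviationForm
  rw [← sum_sub_distrib]
  refine sum_congr rfl fun e _ => ?_
  congr 1
  · simp only [setIndicator, hits, card_filter, ite_mul, one_mul, zero_mul, sum_ite_mem, univ_inter]
    push_cast
    rfl
  · simp [setIndicator, meanHits]

theorem deviationForm_add_left [Fintype ι] (a b : ι → V) (π : ι → Equiv.Perm (Fin n))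
    (f f' g : Fin n × V → ℝ) : deviationForm a b π (f + f') g =
      deviationForm a b π f g + deviationForm a b π f' g := by
  unfold deviationForm
  rw [← sum_add_distrib]
  refine sum_congr rfl fun e _ => ?_
  simp only [Pi.add_apply, add_mul, sum_add_distrib]
  ring

theorem deviationForm_add_right [Fintype ι] (a b : ι → V) (π : ι → Equiv.Perm (Fin n))
    (f g g' : Fin n × V → ℝ) : deviationForm a b π f (g + g') =
      deviationForm a b π f g + deviationForm a b π f g' := by
  unfold deviationForm
  rw [← sum_add_distrib]
  refine sum_congr rfl fun e _ => ?_
  simp only [Pi.add_apply, mul_add, sum_add_distrib]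
  ring

theorem deviationForm_smul_left [Fintype ι] (a b : ι → V) (π : ι → Equiv.Perm (Fin n))
    (c : ℝ) (f g : Fin n × V → ℝ) :
    deviationForm a b π (c • f) g = c * deviationForm a b π f g := by
  unfold deviationForm
  rw [mul_sum]
  refine sum_congr rfl fun e _ => ?_
  simp only [Pi.smul_apply, smul_eq_mul, mul_assoc, ← mul_sum]
  ring

theorem deviationForm_smul_right [Fintype ι] (a b : ι → V) (π : ι → Equiv.Perm (Fin n))
    (c : ℝ) (f g : Fin n × V → ℝ) :
    deviationForm a b π f (c • g) = c * deviationForm a b π f g := by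
  unfold deviationForm
  rw [mul_sum]
  refine sum_congr rfl fun e _ => ?_
  simp only [Pi.smul_apply, smul_eq_mul, mul_left_comm _ c, ← mul_sum]
  ring

/-- `deviationForm` as a bilinear map. -/
noncomputable def deviationBilin [Fintype ι] (a b : ι → V) (π : ι → Equiv.Perm (Fin n)) :
    (Fin n × V → ℝ) →ₗ[ℝ] (Fin n × V → ℝ) →ₗ[ℝ] ℝ :=
  LinearMap.mk₂ ℝ (deviationForm a b π) (deviationForm_add_left a b π)
    (deviationForm_smul_left a b π) (deviationForm_add_right a b π)
    (deviationForm_smul_right a b π)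

/-- The elements whose `k`-th binary digit under `x` is `1`. -/
def digitSet (x : Fin n × V → ℕ) (k : ℕ) (u : V) : Finset (Fin n) := {i | (x (i, u)).testBit k}

theorem sum_digitSet {x : Fin n × V → ℕ} {K : ℕ} (hx : ∀ v, x v < 2 ^ K) :
    (fun v => (x v : ℝ)) = ∑ k ∈ range K, (2 : ℝ) ^ k • setIndicator (digitSet x k) := by
  ext v
  have := sum_testBit K (x v) (hx v)
  rw [← this, Finset.sum_apply]
  push_cast
  refine sum_congr rfl fun k _ => ?_
  simp [setIndicator, digitSet]

theorem sum_four_pow_mul_setSize_le [Fintype V] {x : Fin n × V → ℕ} {K : ℕ}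
    (hx : ∀ v, x v < 2 ^ K) :
    ∑ k ∈ range K, 4 ^ k * setSize (digitSet x k) ≤ ∑ v, (x v : ℝ) ^ 2 := by
  have h1 : ∀ k, setSize (digitSet x k) = ∑ v, (if (x v).testBit k then 1 else 0 : ℝ) := by
    intro k
    rw [Fintype.sum_prod_type_right]
    unfold setSize digitSet
    simp
  simp only [h1, mul_sum]
  rw [sum_comm]
  refine sum_le_sum fun v _ => ?_
  have := sum_testBit_sq_le (hx v)
  have h2 : ((∑ k ∈ range K, (if (x v).testBit k then 4 ^ k else 0) : ℕ) : ℝ) ≤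
      ((x v ^ 2 : ℕ) : ℝ) := by exact_mod_cast this
  push_cast at h2
  simpa using h2

/-- A form of the converse of the expander mixing lemma of Bilu and Linial, for vectors of natural
numbers. -/
theorem abs_deviationForm_natCast_le [Fintype V] [Fintype ι] {a b : ι → V}
    {π : ι → Equiv.Perm (Fin n)} {A B d : ℝ} (hA : 0 ≤ A) (hB : 0 ≤ B) (hd : 0 ≤ d) (h : ℕ)
    (hD1 : ∀ S T : V → Finset (Fin n),
      |∑ e, (hits a b S T π e : ℝ) - ∑ e, meanHits a b S T e| ≤
        A * Real.sqrt (setSize S * setSize T) + B * (setSize S + setSize T))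
    (hD2 : ∀ S T : V → Finset (Fin n),
      |∑ e, (hits a b S T π e : ℝ) - ∑ e, meanHits a b S T e| ≤ d * min (setSize S) (setSize T))
    (x y : Fin n × V → ℕ) :
    |deviationForm a b π (fun v => (x v : ℝ)) (fun v => (y v : ℝ))| ≤
      2 * ((h + 1) * A + B * 2 ^ (h + 1) + d * (1 / 2) ^ h) *
        (∑ v, (x v : ℝ) ^ 2 + ∑ v, (y v : ℝ) ^ 2) := by
  obtain ⟨K, hxK, hyK⟩ : ∃ K, (∀ v, x v < 2 ^ K) ∧ ∀ v, y v < 2 ^ K := by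
    refine ⟨∑ v, (x v + y v), fun v => ?_, fun v => ?_⟩ <;>
    · refine Nat.lt_two_pow_self.trans_le (Nat.pow_le_pow_right (by norm_num) ?_)
      have : x v + y v ≤ ∑ v, (x v + y v) :=
        single_le_sum (f := fun v => x v + y v) (fun _ _ => Nat.zero_le _) (mem_univ v)
      omega
  have hexp : deviationForm a b π (fun v => (x v : ℝ)) (fun v => (y v : ℝ)) =
      ∑ k ∈ range K, ∑ l ∈ range K, 2 ^ (k + l) *
        (∑ e, (hits a b (digitSet x k) (digitSet y l) π e : ℝ) -
          ∑ e, meanHits a b (digitSet x k) (digitSet y l) e) := by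
    have hbil : ∀ f g, deviationForm a b π f g = deviationBilin a b π f g := fun _ _ => rfl
    rw [hbil, sum_digitSet hxK, sum_digitSet hyK]
    simp only [map_sum, LinearMap.sum_apply, map_smul, LinearMap.smul_apply, smul_eq_mul]
    rw [sum_comm]
    refine sum_congr rfl fun l _ => ?_
    rw [mul_sum]
    refine sum_congr rfl fun k _ => ?_
    rw [← deviationForm_setIndicator, hbil, pow_add]
    ring
  rw [hexp]
  refine (sum_abs_le_of_natDist K (scaleWeight_nonneg hA hB hd h)
    (p := fun k => 4 ^ k * setSize (digitSet x k)) (q := fun l => 4 ^ l * setSize (digitSet y l))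
    (fun k => mul_nonneg (by positivity) (setSize_nonneg _))
    (fun k => mul_nonneg (by positivity) (setSize_nonneg _))
    (fun k l => abs_two_pow_mul_le_scaleWeight hA hB hd (setSize_nonneg _) (setSize_nonneg _)
      (hD1 _ _) (hD2 _ _) h k l)).trans ?_
  have h1 := sum_scaleWeight_le hA hB hd h K
  have h2 := sum_four_pow_mul_setSize_le hxK
  have h3 := sum_four_pow_mul_setSize_le hyK
  have h4 : ∀ z : Fin n × V → ℕ, 0 ≤ ∑ k ∈ range K, 4 ^ k * setSize (digitSet z k) := fun z =>
    sum_nonneg fun k _ => mul_nonneg (by positivity) (setSize_nonneg _)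
  have h5 := h4 x
  have h6 := h4 y
  gcongr

/-! ### From natural to real vectors, and choice of the cutoff. -/

/-- Both sides are continuous and homogeneous of degree two, so the bound passes to the limit of the
approximations ⌊fq⌋/q as q tends to infinity. -/
theorem abs_deviationForm_le_of_nonneg [Fintype V] [Fintype ι] {a b : ι → V}
    {π : ι → Equiv.Perm (Fin n)} {W : ℝ}
    (hW : ∀ x y : Fin n × V → ℕ,
      |deviationForm a b π (fun v => (x v : ℝ)) (fun v => (y v : ℝ))| ≤
        W * (∑ v, (x v : ℝ) ^ 2 + ∑ v, (y v : ℝ) ^ 2))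
    (f g : Fin n × V → ℝ) (hf : ∀ v, 0 ≤ f v) (hg : ∀ v, 0 ≤ g v) :
    |deviationForm a b π f g| ≤ W * (∑ v, f v ^ 2 + ∑ v, g v ^ 2) := by
  have hlim : ∀ f : Fin n × V → ℝ, (∀ v, 0 ≤ f v) → ∀ v,
      Filter.Tendsto (fun q : ℝ => (⌊f v * q⌋₊ : ℝ) / q) Filter.atTop (nhds (f v)) :=
    fun f hf v => tendsto_nat_floor_mul_div_atTop (hf v)
  refine le_of_tendsto_of_tendsto (b := Filter.atTop)
    (f := fun q : ℝ => |deviationForm a b π (fun v => (⌊f v * q⌋₊ : ℝ) / q)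
      (fun v => (⌊g v * q⌋₊ : ℝ) / q)|)
    (g := fun q : ℝ => W * (∑ v, ((⌊f v * q⌋₊ : ℝ) / q) ^ 2 + ∑ v, ((⌊g v * q⌋₊ : ℝ) / q) ^ 2))
    ?_ ?_ ?_
  · refine Filter.Tendsto.abs (tendsto_finsetSum _ fun e _ => ?_)
    refine Filter.Tendsto.sub (tendsto_finsetSum _ fun i _ => (hlim f hf _).mul (hlim g hg _)) ?_
    exact ((tendsto_finsetSum _ fun i _ => hlim f hf _).mul
      (tendsto_finsetSum _ fun i _ => hlim g hg _)).div_const _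
  · exact ((tendsto_finsetSum _ fun v _ => (hlim f hf v).pow 2).add
      (tendsto_finsetSum _ fun v _ => (hlim g hg v).pow 2)).const_mul W
  · filter_upwards with q
    have h1 := hW (fun v => ⌊f v * q⌋₊) (fun v => ⌊g v * q⌋₊)
    have h2 : ∀ f : Fin n × V → ℝ, (fun v => (⌊f v * q⌋₊ : ℝ) / q) =
        q⁻¹ • fun v => (⌊f v * q⌋₊ : ℝ) := fun f => by
      ext v; simp [div_eq_inv_mul]
    rw [h2, h2, deviationForm_smul_left, deviationForm_smul_right, ← mul_assoc, abs_mul,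
      abs_of_nonneg (mul_self_nonneg q⁻¹)]
    refine (mul_le_mul_of_nonneg_left h1 (mul_self_nonneg q⁻¹)).trans (le_of_eq ?_)
    simp only [div_eq_mul_inv, mul_pow, ← sum_mul]
    ring

/-- The positive and negative parts of `f` have disjoint supports, so their squared norms add up;
the four resulting terms total 4W. -/
theorem abs_deviationForm_self_le [Fintype V] [Fintype ι] {a b : ι → V}
    {π : ι → Equiv.Perm (Fin n)} {W : ℝ}
    (hW : ∀ x y : Fin n × V → ℕ,
      |deviationForm a b π (fun v => (x v : ℝ)) (fun v => (y v : ℝ))| ≤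
        W * (∑ v, (x v : ℝ) ^ 2 + ∑ v, (y v : ℝ) ^ 2))
    (f : Fin n × V → ℝ) :
    |deviationForm a b π f f| ≤ 4 * W * ∑ v, f v ^ 2 := by
  set p : Fin n × V → ℝ := fun v => max (f v) 0 with hp
  set m : Fin n × V → ℝ := fun v => max (-f v) 0 with hm
  have hp0 : ∀ v, 0 ≤ p v := fun v => le_max_right _ _
  have hm0 : ∀ v, 0 ≤ m v := fun v => le_max_right _ _
  have hf : f = p + (-1 : ℝ) • m := by
    ext v
    simp only [hp, hm, Pi.add_apply, Pi.smul_apply, smul_eq_mul]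
    rcases le_total 0 (f v) with h | h
    · rw [max_eq_left h, max_eq_right (by linarith)]; ring
    · rw [max_eq_right h, max_eq_left (by linarith)]; ring
  have hsq : ∑ v, f v ^ 2 = ∑ v, p v ^ 2 + ∑ v, m v ^ 2 := by
    rw [← sum_add_distrib]
    refine sum_congr rfl fun v _ => ?_
    simp only [hp, hm]
    rcases le_total 0 (f v) with h | h
    · rw [max_eq_left h, max_eq_right (by linarith)]; ring
    · rw [max_eq_right h, max_eq_left (by linarith)]; ring
  have hexp : deviationForm a b π f f = deviationForm a b π p p - deviationForm a b π p m -
      deviationForm a b π m p + deviationForm a b π m m := by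
    conv_lhs => rw [hf]
    simp only [deviationForm_add_left, deviationForm_add_right, deviationForm_smul_left,
      deviationForm_smul_right]
    ring
  have h1 := abs_le.1 (abs_deviationForm_le_of_nonneg hW p p hp0 hp0)
  have h2 := abs_le.1 (abs_deviationForm_le_of_nonneg hW p m hp0 hm0)
  have h3 := abs_le.1 (abs_deviationForm_le_of_nonneg hW m p hm0 hp0)
  have h4 := abs_le.1 (abs_deviationForm_le_of_nonneg hW m m hm0 hm0)
  rw [hexp, hsq, abs_le]
  constructor <;> linarith [h1.1, h1.2, h2.1, h2.2, h3.1, h3.2, h4.1, h4.2]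

/-- The cutoff between near and distant digits: 2^h of order √d makes both 2^h log d and d 2^(-h) at
most of order √d log d. -/
theorem exists_two_pow_near_sqrt {d : ℝ} (hd : 3 ≤ d) :
    ∃ h : ℕ, Real.sqrt d ≤ 2 ^ h ∧ (2 : ℝ) ^ h ≤ 2 * Real.sqrt d ∧ (h : ℝ) + 1 ≤ 3 * Real.log d := by
  have hlog : 1 ≤ Real.log d := by
    rw [Real.le_log_iff_exp_le (by linarith)]
    linarith [Real.exp_one_lt_d9]
  have h1 : 1 ≤ Real.sqrt d := Real.one_le_sqrt.2 (by linarith)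
  obtain ⟨h, hh1, hh2⟩ := exists_nat_pow_near h1 (show (1 : ℝ) < 2 by norm_num)
  refine ⟨h + 1, hh2.le, by rw [pow_succ]; linarith, ?_⟩
  have h2 := Real.log_le_log (by positivity) hh1
  rw [Real.log_pow, Real.log_sqrt (by linarith)] at h2
  have h3 := Real.log_two_gt_d9
  push_cast
  nlinarith [show (0 : ℝ) ≤ h by positivity]

/-- The quadratic form of a concentrated lift deviates little from its expectation. -/
theorem abs_deviationForm_le [Fintype V] [Fintype ι] {a b : ι → V} {d : ℕ} {α : ℝ} (hd : 3 ≤ d)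
    (hα : Real.sqrt d ≤ α)
    (ha : ∀ x : V → ℝ, (∀ u, 0 ≤ x u) → ∑ e, x (a e) ≤ d * ∑ u, x u)
    (hb : ∀ x : V → ℝ, (∀ u, 0 ≤ x u) → ∑ e, x (b e) ≤ d * ∑ u, x u)
    (hmix : ∀ x y : V → ℝ, (∀ u, 0 ≤ x u) → (∀ u, 0 ≤ y u) → ∑ e, x (a e) * y (b e) ≤
      d / Fintype.card V * ((∑ u, x u) * ∑ u, y u) +
        α * (Real.sqrt (∑ u, x u ^ 2) * Real.sqrt (∑ u, y u ^ 2)))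
    (hn : 1 ≤ n) {π : ι → Equiv.Perm (Fin n)}
    (hπ : ∀ S T : V → Finset (Fin n),
      |∑ e, (hits a b S T π e : ℝ) - ∑ e, meanHits a b S T e| ≤ 2 * pairExponent S T +
        2 * Real.sqrt ((∑ e, meanHits a b S T e) * pairExponent S T) ∧
      ∑ e, thinWeight a b d S T e * hits a b S T π e ≤
        ∑ e, (Real.exp (thinWeight a b d S T e) - 1) * meanHits a b S T e + pairExponent S T)
    (f : Fin n × V → ℝ) :
    |deviationForm a b π f f| ≤ 150000 * (α * Real.log d) * ∑ v, f v ^ 2 := by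
  have hd' : (3 : ℝ) ≤ d := by exact_mod_cast hd
  have hlog : 1 ≤ Real.log d := by
    rw [Real.le_log_iff_exp_le (by linarith)]
    linarith [Real.exp_one_lt_d9]
  have hα0 : 0 ≤ α := (Real.sqrt_nonneg _).trans hα
  obtain ⟨h, h1, h2, h3⟩ := exists_two_pow_near_sqrt hd'
  have hnat := abs_deviationForm_natCast_le (by positivity : 0 ≤ 32 * α)
    (by positivity : 0 ≤ 4000 * Real.log d) (by positivity : (0 : ℝ) ≤ d) h
    (fun S T => abs_discrepancy_le hd hα ha hb hmix hn hπ S T)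
    (fun S T => abs_sub_le_mul_setSize ha hb π S T)
  refine (abs_deviationForm_self_le hnat f).trans ?_
  have hsum : 0 ≤ ∑ v, f v ^ 2 := sum_nonneg fun _ _ => sq_nonneg _
  refine mul_le_mul_of_nonneg_right ?_ hsum
  have hsq : Real.sqrt d * Real.sqrt d = d := Real.mul_self_sqrt (by linarith)
  have hs0 : 0 < Real.sqrt d := Real.sqrt_pos.2 (by linarith)
  have e1 : (d : ℝ) * (1 / 2) ^ h ≤ Real.sqrt d := by
    rw [one_div, inv_pow, ← div_eq_mul_inv, div_le_iff₀ (by positivity)]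
    nlinarith
  have e2 : 4000 * Real.log d * 2 ^ (h + 1) ≤ 16000 * (α * Real.log d) := by
    rw [pow_succ]
    have : (2 : ℝ) ^ h ≤ 2 * α := by linarith
    nlinarith
  have e3 : ((h : ℝ) + 1) * (32 * α) ≤ 96 * (α * Real.log d) := by nlinarith
  have e4 : α ≤ α * Real.log d := le_mul_of_one_le_right hα0 hlog
  -- The total is 8 · (96 + 16000 + 1) ≤ 150000 times α log d.
  linarith

end

/-! ### Spectrum of a regular graph -/

section

open Finset

theorem exists_orthonormal_eigenvectors {W : Type*} [Fintype W] (H : SimpleGraph W) :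
    ∃ v : Fin (Fintype.card W) → W → ℝ,
      (∀ i j, ∑ x, v i x * v j x = if i = j then 1 else 0) ∧
      (∀ f g : W → ℝ, ∑ i, (∑ x, f x * v i x) * (∑ x, g x * v i x) = ∑ x, f x * g x) ∧
      ∀ i x, ∑ y, adjacencyMatrix H x y * v i y = graphEigenvalue H i * v i x := by
  classical
  have hA := adjacencyMatrix_isHermitian H
  set σ : Fin (Fintype.card W) ≃ W := Fintype.equivOfCardEq (Fintype.card_fin _) with hσ
  set b := hA.eigenvectorBasis with hb
  refine ⟨fun i x => b (σ i) x, fun i j => ?_, fun f g => ?_, fun i x => ?_⟩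
  · have h := orthonormal_iff_ite.1 b.orthonormal (σ i) (σ j)
    rw [EuclideanSpace.inner_eq_star_dotProduct] at h
    simp only [σ.injective.eq_iff] at h
    rw [← h]
    simp [dotProduct, mul_comm]
  · have h := b.sum_inner_mul_inner (WithLp.toLp 2 f) (WithLp.toLp 2 g)
    simp only [EuclideanSpace.inner_eq_star_dotProduct] at h
    rw [← σ.sum_comp] at h
    simp only [dotProduct, star_trivial] at h
    rw [show ∑ x, f x * g x = ∑ x, g x * f x from sum_congr rfl fun x _ => mul_comm _ _, ← h]
    refine sum_congr rfl fun i _ => ?_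
    congr 1
    exact sum_congr rfl fun x _ => mul_comm _ _
  · have h := congrFun (hA.mulVec_eigenvectorBasis (σ i)) x
    have hev : hA.eigenvalues (σ i) = graphEigenvalue H i := by
      unfold graphEigenvalue Matrix.IsHermitian.eigenvalues
      congr 1
      exact σ.symm_apply_apply i
    rw [hev] at h
    simpa [Matrix.mulVec, dotProduct] using h

theorem graphEigenvalue_antitone {W : Type*} [Fintype W] (H : SimpleGraph W) :
    Antitone (graphEigenvalue H) := by
  classical
  exact (adjacencyMatrix_isHermitian H).eigenvalues₀_antitone

theorem adjacencyMatrix_comm {W : Type*} (H : SimpleGraph W) (x y : W) :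
    adjacencyMatrix H x y = adjacencyMatrix H y x := by
  have := (adjacencyMatrix_isHermitian H).apply x y
  simpa using this.symm

/-- Pairing the eigenvalue equation with the constant function: an eigenvector whose eigenvalue is
not `d` has sum zero. -/
theorem eigenvalue_mul_sum_eq {W : Type*} [Fintype W] {H : SimpleGraph W} {d l : ℝ}
    (hreg : ∀ φ : W → ℝ, ∑ x, ∑ y, adjacencyMatrix H x y * φ x = d * ∑ x, φ x) {v : W → ℝ}
    (hv : ∀ x, ∑ y, adjacencyMatrix H x y * v y = l * v x) :
    l * ∑ x, v x = d * ∑ x, v x := by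
  rw [← hreg v, mul_sum, ← sum_congr rfl fun x _ => hv x, sum_comm]
  exact sum_congr rfl fun x _ => sum_congr rfl fun y _ => by rw [adjacencyMatrix_comm]

/-- An eigenvector with sum zero is a test function for `hquad`. The basis need not contain the
constant vector, so a nontrivial eigenvector may have nonzero sum; its eigenvalue is then `d`, the
top eigenvalue is at least `d`, and the combination of the two eigenvectors with sum zero shows d ≤
β. -/
theorem nontrivialEigenvaluesLE_of_quadratic_form_le {W : Type*} [Fintype W] {H : SimpleGraph W}
    {d β : ℝ} (hd : 0 ≤ d)
    (hreg : ∀ φ : W → ℝ, ∑ x, ∑ y, adjacencyMatrix H x y * φ x = d * ∑ x, φ x)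
    (hquad : ∀ f : W → ℝ, ∑ x, f x = 0 →
      |∑ x, f x * ∑ y, adjacencyMatrix H x y * f y| ≤ β * ∑ x, f x ^ 2) :
    NontrivialEigenvaluesLE H β := by
  obtain ⟨v, horth, -, heig⟩ := exists_orthonormal_eigenvectors H
  intro i hi
  have hself : ∀ i, ∑ x, v i x ^ 2 = 1 := fun i => by
    have := horth i i
    simpa [sq] using this
  have hzero : ∑ x, v i x = 0 → |graphEigenvalue H i| ≤ β := by
    intro h0
    have h := hquad (v i) h0
    simp only [heig] at h
    rw [hself, mul_one] at h
    convert h using 2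
    calc graphEigenvalue H i = graphEigenvalue H i * ∑ x, v i x ^ 2 := by rw [hself, mul_one]
      _ = _ := by
          rw [mul_sum]
          exact sum_congr rfl fun x _ => by ring
  by_cases h0 : ∑ x, v i x = 0
  · exact hzero h0
  have hev : graphEigenvalue H i = d :=
    mul_right_cancel₀ h0 (eigenvalue_mul_sum_eq hreg (heig i))
  set o : Fin (Fintype.card W) := ⟨0, (Nat.zero_le _).trans_lt i.2⟩ with ho
  have hoi : o ≠ i := fun h => hi (by rw [← h])
  have hmono : graphEigenvalue H i ≤ graphEigenvalue H o :=
    graphEigenvalue_antitone H (Fin.mk_le_of_le_val (Nat.zero_le _))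
  rw [abs_of_nonneg (hev ▸ hd)]
  set s := ∑ x, v i x with hs
  set r := ∑ x, v o x with hr
  have hcross : ∑ x, v o x * v i x = 0 := by rw [horth, if_neg hoi]
  have hsum : ∑ x, (s * v o x - r * v i x) = 0 := by
    rw [sum_sub_distrib, ← mul_sum, ← mul_sum]; ring
  have h := hquad _ hsum
  have hA : ∀ x, ∑ y, adjacencyMatrix H x y * (s * v o y - r * v i y) =
      s * (graphEigenvalue H o * v o x) - r * (graphEigenvalue H i * v i x) := by
    intro x
    rw [← heig, ← heig, mul_sum, mul_sum, ← sum_sub_distrib]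
    exact sum_congr rfl fun y _ => by ring
  have hq : ∑ x, (s * v o x - r * v i x) *
      ∑ y, adjacencyMatrix H x y * (s * v o y - r * v i y) =
      s ^ 2 * graphEigenvalue H o + r ^ 2 * graphEigenvalue H i := by
    calc _ = s ^ 2 * graphEigenvalue H o * ∑ x, v o x ^ 2 +
          r ^ 2 * graphEigenvalue H i * ∑ x, v i x ^ 2 -
          s * r * (graphEigenvalue H o + graphEigenvalue H i) * ∑ x, v o x * v i x := by
          simp only [hA, mul_sum, ← sum_add_distrib, ← sum_sub_distrib]
          exact sum_congr rfl fun x _ => by ring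
      _ = _ := by rw [hself, hself, hcross]; ring
  have hn : ∑ x, (s * v o x - r * v i x) ^ 2 = s ^ 2 + r ^ 2 := by
    calc _ = s ^ 2 * ∑ x, v o x ^ 2 + r ^ 2 * ∑ x, v i x ^ 2 -
          2 * s * r * ∑ x, v o x * v i x := by
          simp only [mul_sum, ← sum_add_distrib, ← sum_sub_distrib]
          exact sum_congr rfl fun x _ => by ring
      _ = _ := by rw [hself, hself, hcross]; ring
  rw [hq, hn] at h
  have h' := (le_abs_self _).trans h
  have hs2 : 0 < s ^ 2 + r ^ 2 := by positivity
  refine le_of_mul_le_mul_right ?_ hs2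
  nlinarith [sq_nonneg s]

theorem adjacencyMatrix_mul_self_apply {W : Type*} (H : SimpleGraph W) (x y : W) :
    adjacencyMatrix H x y * adjacencyMatrix H x y = adjacencyMatrix H x y := by
  classical
  unfold adjacencyMatrix
  rw [SimpleGraph.adjMatrix_apply]
  split_ifs <;> simp

/-- Cauchy–Schwarz over the ordered pairs of adjacent vertices, each vertex occurring `d` times on
either side. -/
theorem abs_quadratic_form_le_of_regular {W : Type*} [Fintype W] {H : SimpleGraph W}
    {d : ℝ} (hd : 0 ≤ d)
    (hreg : ∀ φ : W → ℝ, ∑ x, ∑ y, adjacencyMatrix H x y * φ x = d * ∑ x, φ x) (f g : W → ℝ) :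
    |∑ x, f x * ∑ y, adjacencyMatrix H x y * g y| ≤
      d * (Real.sqrt (∑ x, f x ^ 2) * Real.sqrt (∑ x, g x ^ 2)) := by
  have hcs := sum_mul_sq_le_sq_mul_sq (univ : Finset (W × W))
    (fun p => adjacencyMatrix H p.1 p.2 * f p.1) (fun p => adjacencyMatrix H p.1 p.2 * g p.2)
  have e0 : ∑ p : W × W, adjacencyMatrix H p.1 p.2 * f p.1 * (adjacencyMatrix H p.1 p.2 * g p.2) =
      ∑ x, f x * ∑ y, adjacencyMatrix H x y * g y := by
    rw [Fintype.sum_prod_type]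
    simp only [mul_sum]
    refine sum_congr rfl fun x _ => sum_congr rfl fun y _ => ?_
    linear_combination (f x * g y) * adjacencyMatrix_mul_self_apply H x y
  have e1 : ∑ p : W × W, (adjacencyMatrix H p.1 p.2 * f p.1) ^ 2 = d * ∑ x, f x ^ 2 := by
    rw [Fintype.sum_prod_type, ← hreg]
    refine sum_congr rfl fun x _ => sum_congr rfl fun y _ => ?_
    linear_combination (f x ^ 2) * adjacencyMatrix_mul_self_apply H x y
  have e2 : ∑ p : W × W, (adjacencyMatrix H p.1 p.2 * g p.2) ^ 2 = d * ∑ x, g x ^ 2 := by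
    rw [Fintype.sum_prod_type, ← hreg, sum_comm]
    refine sum_congr rfl fun x _ => sum_congr rfl fun y _ => ?_
    rw [adjacencyMatrix_comm H y x]
    linear_combination (g x ^ 2) * adjacencyMatrix_mul_self_apply H x y
  rw [e0, e1, e2] at hcs
  refine abs_le_of_sq_le_sq (hcs.trans (le_of_eq ?_)) (by positivity)
  rw [mul_pow, mul_pow, Real.sq_sqrt (sum_nonneg fun _ _ => sq_nonneg _),
    Real.sq_sqrt (sum_nonneg fun _ _ => sq_nonneg _)]
  ring

/-- The expander mixing lemma for real-valued functions, with a spectral bound below the degree. -/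
theorem abs_bilinear_form_sub_le {W : Type*} [Fintype W] [Nonempty W] {H : SimpleGraph W}
    {d β : ℝ} (hβ : 0 ≤ β) (hβd : β < d)
    (hreg : ∀ φ : W → ℝ, ∑ x, ∑ y, adjacencyMatrix H x y * φ x = d * ∑ x, φ x)
    (hH : NontrivialEigenvaluesLE H β) (f g : W → ℝ) :
    |∑ x, f x * ∑ y, adjacencyMatrix H x y * g y -
      d / Fintype.card W * ((∑ x, f x) * ∑ x, g x)| ≤
      β * (Real.sqrt (∑ x, f x ^ 2) * Real.sqrt (∑ x, g x ^ 2)) := by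
  obtain ⟨v, horth, hpars, heig⟩ := exists_orthonormal_eigenvectors H
  have hN : (0 : ℝ) < Fintype.card W := by exact_mod_cast Fintype.card_pos
  set c : Fin (Fintype.card W) → (W → ℝ) → ℝ := fun i f => ∑ x, f x * v i x with hc
  set o : Fin (Fintype.card W) := ⟨0, Fintype.card_pos⟩ with ho
  -- Since β < d, no nontrivial eigenvalue equals `d`. All eigenvectors but the first are thus
  -- orthogonal to the constants, and by Parseval the first carries the whole sum of a function.
  have hsum0 : ∀ i ≠ o, ∑ x, v i x = 0 := by
    intro i hi
    by_contra h0
    have hev : graphEigenvalue H i = d :=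
      mul_right_cancel₀ h0 (eigenvalue_mul_sum_eq hreg (heig i))
    have := hH i fun h => hi (Fin.ext h)
    rw [hev] at this
    linarith [le_abs_self d]
  have hconst : ∀ f : W → ℝ, (∑ x, v o x) * c o f = ∑ x, f x := by
    intro f
    have h := hpars (fun _ => 1) f
    simp only [one_mul] at h
    rw [← h]
    refine (Fintype.sum_eq_single (f := fun i => (∑ x, v i x) * c i f) o fun i hi => ?_).symm
    rw [hsum0 i hi, zero_mul]
  have hsq : (∑ x, v o x) * ∑ x, v o x = Fintype.card W := by
    have := hconst fun _ => 1
    simpa [hc] using this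
  have hne : ∑ x, v o x ≠ 0 := fun h => by rw [h] at hsq; linarith
  have hevo : graphEigenvalue H o = d :=
    mul_right_cancel₀ hne (eigenvalue_mul_sum_eq hreg (heig o))
  have hcA : ∀ i, c i (fun x => ∑ y, adjacencyMatrix H x y * g y) =
      graphEigenvalue H i * c i g := by
    intro i
    calc c i (fun x => ∑ y, adjacencyMatrix H x y * g y)
        = ∑ y, g y * ∑ x, adjacencyMatrix H y x * v i x := by
          simp only [hc, sum_mul, mul_sum]
          rw [sum_comm]
          refine sum_congr rfl fun x _ => sum_congr rfl fun y _ => ?_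
          rw [adjacencyMatrix_comm]; ring
      _ = _ := by
          simp only [heig, hc, mul_sum]
          exact sum_congr rfl fun x _ => by ring
  have hform : ∑ x, f x * ∑ y, adjacencyMatrix H x y * g y =
      ∑ i, c i f * (graphEigenvalue H i * c i g) := by
    rw [← hpars]
    exact sum_congr rfl fun i _ => by rw [← hcA]
  have htop : c o f * (graphEigenvalue H o * c o g) =
      d / Fintype.card W * ((∑ x, f x) * ∑ x, g x) := by
    rw [← hconst f, ← hconst g, hevo, div_mul_eq_mul_div, eq_div_iff hN.ne', ← hsq]
    ring
  have hrest : ∑ x, f x * ∑ y, adjacencyMatrix H x y * g y -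
      d / Fintype.card W * ((∑ x, f x) * ∑ x, g x) =
      ∑ i ∈ univ.erase o, c i f * (graphEigenvalue H i * c i g) := by
    rw [hform, ← sum_erase_add _ _ (mem_univ o), htop]; ring
  have hnorm : ∀ f : W → ℝ, ∑ i, |c i f| ^ 2 = ∑ x, f x ^ 2 := by
    intro f
    have := hpars f f
    simp only [sq_abs]
    simp only [sq]
    exact this
  rw [hrest]
  calc |∑ i ∈ univ.erase o, c i f * (graphEigenvalue H i * c i g)|
      ≤ ∑ i ∈ univ.erase o, β * (|c i f| * |c i g|) := by
        refine (abs_sum_le_sum_abs _ _).trans (sum_le_sum fun i hi => ?_)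
        rw [abs_mul, abs_mul, mul_left_comm]
        exact mul_le_mul_of_nonneg_right
          (hH i fun h => ne_of_mem_erase hi (Fin.ext h)) (by positivity)
    _ ≤ ∑ i, β * (|c i f| * |c i g|) :=
        sum_le_sum_of_subset_of_nonneg (erase_subset _ _) fun _ _ _ => by positivity
    _ = β * ∑ i, |c i f| * |c i g| := by rw [mul_sum]
    _ ≤ _ := by
        refine mul_le_mul_of_nonneg_left ?_ hβ
        have := Real.sum_mul_le_sqrt_mul_sqrt univ (fun i => |c i f|) fun i => |c i g|
        rwa [hnorm, hnorm] at this

/-- When β ≥ d the mixing lemma is unavailable, but Cauchy–Schwarz already gives the bound; `hfg`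
makes the extra main term harmless. -/
theorem bilinear_form_le {W : Type*} [Fintype W] {H : SimpleGraph W}
    {d β : ℝ} (hd : 0 ≤ d) (hβ : 0 ≤ β)
    (hreg : ∀ φ : W → ℝ, ∑ x, ∑ y, adjacencyMatrix H x y * φ x = d * ∑ x, φ x)
    (hH : NontrivialEigenvaluesLE H β) {f g : W → ℝ} (hfg : 0 ≤ (∑ x, f x) * ∑ x, g x) :
    ∑ x, f x * ∑ y, adjacencyMatrix H x y * g y ≤
      d / Fintype.card W * ((∑ x, f x) * ∑ x, g x) +
      β * (Real.sqrt (∑ x, f x ^ 2) * Real.sqrt (∑ x, g x ^ 2)) := by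
  rcases isEmpty_or_nonempty W with hW | hW
  · simp
  rcases lt_or_ge β d with h | h
  · have := (abs_le.1 (abs_bilinear_form_sub_le hβ h hreg hH f g)).2
    linarith
  · have h1 := (le_abs_self _).trans (abs_quadratic_form_le_of_regular hd hreg f g)
    have h2 : d * (Real.sqrt (∑ x, f x ^ 2) * Real.sqrt (∑ x, g x ^ 2)) ≤
        β * (Real.sqrt (∑ x, f x ^ 2) * Real.sqrt (∑ x, g x ^ 2)) := by gcongr
    have h3 : 0 ≤ d / Fintype.card W * ((∑ x, f x) * ∑ x, g x) := by positivity
    linarith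

theorem abs_quadratic_form_le {W : Type*} [Fintype W] {H : SimpleGraph W}
    {d β : ℝ} (hd : 0 ≤ d) (hβ : 0 ≤ β)
    (hreg : ∀ φ : W → ℝ, ∑ x, ∑ y, adjacencyMatrix H x y * φ x = d * ∑ x, φ x)
    (hH : NontrivialEigenvaluesLE H β) {f : W → ℝ} (hf : ∑ x, f x = 0) :
    |∑ x, f x * ∑ y, adjacencyMatrix H x y * f y| ≤ β * ∑ x, f x ^ 2 := by
  rcases isEmpty_or_nonempty W with hW | hW
  · simp
  have hsq : Real.sqrt (∑ x, f x ^ 2) * Real.sqrt (∑ x, f x ^ 2) = ∑ x, f x ^ 2 :=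
    Real.mul_self_sqrt (sum_nonneg fun _ _ => sq_nonneg _)
  rcases lt_or_ge β d with h | h
  · have := abs_bilinear_form_sub_le hβ h hreg hH f f
    rwa [hf, zero_mul, mul_zero, sub_zero, hsq] at this
  · have := abs_quadratic_form_le_of_regular hd hreg f f
    rw [hsq] at this
    exact this.trans (mul_le_mul_of_nonneg_right h (sum_nonneg fun _ _ => sq_nonneg _))

end

/-! ### The lift of a regular graph -/

section

open Finset

theorem ite_exists_eq_sum {ι : Type*} [Fintype ι] (p q : ι → Prop) [DecidablePred p]
    [DecidablePred q] [Decidable ((∃ e, p e) ∨ ∃ e, q e)]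
    (huniq : ∀ e e', p e ∨ q e → p e' ∨ q e' → e = e') (hpq : ∀ e, ¬(p e ∧ q e)) :
    (if (∃ e, p e) ∨ ∃ e, q e then (1 : ℝ) else 0) =
      ∑ e, ((if p e then 1 else 0) + if q e then 1 else 0) := by
  split_ifs with h
  · obtain ⟨e, he⟩ : ∃ e, p e ∨ q e := by
      rcases h with ⟨e, he⟩ | ⟨e, he⟩
      · exact ⟨e, Or.inl he⟩
      · exact ⟨e, Or.inr he⟩
    rw [Fintype.sum_eq_single e]
    · rcases he with h1 | h1
      · have h2 : ¬q e := fun h2 => hpq e ⟨h1, h2⟩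
        simp [h1, h2]
      · have h2 : ¬p e := fun h2 => hpq e ⟨h2, h1⟩
        simp [h1, h2]
    · intro e' he'
      have h1 : ¬p e' := fun h1 => he' (huniq e' e (Or.inl h1) he)
      have h2 : ¬q e' := fun h2 => he' (huniq e' e (Or.inr h2) he)
      simp [h1, h2]
  · push Not at h
    simp [h.1, h.2]

variable {V : Type*}

/-- The first end point of an edge, in the orientation used by `liftGraph`. -/
noncomputable def firstEnd (G : SimpleGraph V) (e : G.edgeSet) : V := (Quot.out (e : Sym2 V)).1

/-- The second end point of an edge, in the orientation used by `liftGraph`. -/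
noncomputable def secondEnd (G : SimpleGraph V) (e : G.edgeSet) : V := (Quot.out (e : Sym2 V)).2

theorem edge_eq_of_out_eq {G : SimpleGraph V} {e : G.edgeSet} {u v : V}
    (h : Quot.out (e : Sym2 V) = (u, v)) : (e : Sym2 V) = s(u, v) := by
  rw [← Quot.out_eq (e : Sym2 V), h]

theorem adj_of_out_eq {G : SimpleGraph V} {e : G.edgeSet} {u v : V}
    (h : Quot.out (e : Sym2 V) = (u, v)) : G.Adj u v := by
  have := e.2
  rwa [edge_eq_of_out_eq h, SimpleGraph.mem_edgeSet] at this

theorem out_unique {G : SimpleGraph V} {u v : V} {e e' : G.edgeSet}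
    (he : Quot.out (e : Sym2 V) = (u, v) ∨ Quot.out (e : Sym2 V) = (v, u))
    (he' : Quot.out (e' : Sym2 V) = (u, v) ∨ Quot.out (e' : Sym2 V) = (v, u)) : e = e' := by
  have key : ∀ e : G.edgeSet, Quot.out (e : Sym2 V) = (u, v) ∨ Quot.out (e : Sym2 V) = (v, u) →
      (e : Sym2 V) = s(u, v) := by
    intro e he
    rcases he with h | h
    · exact edge_eq_of_out_eq h
    · rw [edge_eq_of_out_eq h, Sym2.eq_swap]
  exact Subtype.ext ((key e he).trans (key e' he').symm)

theorem adj_iff_exists_out (G : SimpleGraph V) (u v : V) :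
    G.Adj u v ↔ (∃ e : G.edgeSet, Quot.out (e : Sym2 V) = (u, v)) ∨
      ∃ e : G.edgeSet, Quot.out (e : Sym2 V) = (v, u) := by
  constructor
  · intro h
    have hq := Quot.out_eq (s(u, v) : Sym2 V)
    have hmk : s((Quot.out s(u, v)).1, (Quot.out s(u, v)).2) = s(u, v) := hq
    rw [Sym2.eq_iff] at hmk
    rcases hmk with hm | hm
    · exact Or.inl ⟨⟨s(u, v), h⟩, Prod.ext hm.1 hm.2⟩
    · exact Or.inr ⟨⟨s(u, v), h⟩, Prod.ext hm.1 hm.2⟩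
  · rintro (⟨e, he⟩ | ⟨e, he⟩)
    · exact adj_of_out_eq he
    · exact (adj_of_out_eq he).symm

theorem liftGraph_adj_iff (G : SimpleGraph V) (n : ℕ) (π : LiftData G n) (x y : Fin n × V) :
    (liftGraph G n π).Adj x y ↔
      (∃ e : G.edgeSet, Quot.out (e : Sym2 V) = (x.2, y.2) ∧ π e x.1 = y.1) ∨
      ∃ e : G.edgeSet, Quot.out (e : Sym2 V) = (y.2, x.2) ∧ π e y.1 = x.1 := by
  unfold liftGraph
  rw [SimpleGraph.fromRel_adj]
  refine ⟨fun h => h.2, fun h => ⟨?_, h⟩⟩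
  rintro rfl
  rcases h with ⟨e, he, -⟩ | ⟨e, he, -⟩ <;> exact (adj_of_out_eq he).ne rfl

open Classical in
theorem adjacencyMatrix_apply_eq_sum (G : SimpleGraph V) [Fintype G.edgeSet] (u v : V) :
    adjacencyMatrix G u v = ∑ e : G.edgeSet,
      ((if Quot.out (e : Sym2 V) = (u, v) then 1 else 0) +
        if Quot.out (e : Sym2 V) = (v, u) then 1 else 0) := by
  unfold adjacencyMatrix
  rw [SimpleGraph.adjMatrix_apply, ← ite_exists_eq_sum _ _ (fun e e' => out_unique)]
  · simp only [adj_iff_exists_out]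
  · rintro e ⟨h1, h2⟩
    have := adj_of_out_eq h1
    rw [h1, Prod.mk.injEq] at h2
    exact this.ne h2.1

open Classical in
theorem adjacencyMatrix_liftGraph_apply (G : SimpleGraph V) [Fintype G.edgeSet] (n : ℕ)
    (π : LiftData G n) (x y : Fin n × V) :
    adjacencyMatrix (liftGraph G n π) x y = ∑ e : G.edgeSet,
      ((if Quot.out (e : Sym2 V) = (x.2, y.2) ∧ π e x.1 = y.1 then 1 else 0) +
        if Quot.out (e : Sym2 V) = (y.2, x.2) ∧ π e y.1 = x.1 then 1 else 0) := by
  unfold adjacencyMatrix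
  rw [SimpleGraph.adjMatrix_apply, ← ite_exists_eq_sum _ _ (fun e e' he he' => out_unique
    (he.imp And.left And.left) (he'.imp And.left And.left))]
  · simp only [liftGraph_adj_iff]
  · rintro e ⟨⟨h1, -⟩, ⟨h2, -⟩⟩
    have := adj_of_out_eq h1
    rw [h1, Prod.mk.injEq] at h2
    exact this.ne h2.1

theorem sum_adjacencyMatrix_mul [Fintype V] (G : SimpleGraph V) [Fintype G.edgeSet]
    (F : V → V → ℝ) :
    ∑ u, ∑ v, adjacencyMatrix G u v * F u v = ∑ e : G.edgeSet,
      (F (firstEnd G e) (secondEnd G e) + F (secondEnd G e) (firstEnd G e)) := by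
  classical
  simp only [adjacencyMatrix_apply_eq_sum, sum_mul]
  have h : ∀ u, ∑ v, ∑ e : G.edgeSet, ((if Quot.out (e : Sym2 V) = (u, v) then (1 : ℝ) else 0) +
        if Quot.out (e : Sym2 V) = (v, u) then 1 else 0) * F u v =
      ∑ e : G.edgeSet, ∑ v, ((if Quot.out (e : Sym2 V) = (u, v) then (1 : ℝ) else 0) +
        if Quot.out (e : Sym2 V) = (v, u) then 1 else 0) * F u v := fun u => sum_comm
  simp only [h]
  rw [sum_comm]
  refine sum_congr rfl fun e _ => ?_
  simp only [add_mul, sum_add_distrib]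
  have h1 : ∀ u v : V, (Quot.out (e : Sym2 V) = (u, v)) ↔ (firstEnd G e = u ∧ secondEnd G e = v) :=
    fun u v => Prod.ext_iff
  simp [h1, ite_and]

theorem sum_adjacencyMatrix_liftGraph_mul [Fintype V] (G : SimpleGraph V) [Fintype G.edgeSet]
    (n : ℕ) (π : LiftData G n) (F : Fin n × V → Fin n × V → ℝ) :
    ∑ x, ∑ y, adjacencyMatrix (liftGraph G n π) x y * F x y = ∑ e : G.edgeSet, ∑ i,
      (F (i, firstEnd G e) (π e i, secondEnd G e) +
        F (π e i, secondEnd G e) (i, firstEnd G e)) := by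
  classical
  simp only [adjacencyMatrix_liftGraph_apply, sum_mul]
  have h : ∀ x : Fin n × V, ∑ y : Fin n × V, ∑ e : G.edgeSet,
        ((if Quot.out (e : Sym2 V) = (x.2, y.2) ∧ π e x.1 = y.1 then (1 : ℝ) else 0) +
        if Quot.out (e : Sym2 V) = (y.2, x.2) ∧ π e y.1 = x.1 then 1 else 0) * F x y =
      ∑ e : G.edgeSet, ∑ y : Fin n × V,
        ((if Quot.out (e : Sym2 V) = (x.2, y.2) ∧ π e x.1 = y.1 then (1 : ℝ) else 0) +
        if Quot.out (e : Sym2 V) = (y.2, x.2) ∧ π e y.1 = x.1 then 1 else 0) * F x y :=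
    fun x => sum_comm
  simp only [h]
  rw [sum_comm]
  refine sum_congr rfl fun e _ => ?_
  simp only [add_mul, sum_add_distrib]
  have h1 : ∀ u v : V, (Quot.out (e : Sym2 V) = (u, v)) ↔ (firstEnd G e = u ∧ secondEnd G e = v) :=
    fun u v => Prod.ext_iff
  congr 1
  · simp [h1, ite_and, Fintype.sum_prod_type]
  · rw [sum_comm]
    simp [h1, ite_and, Fintype.sum_prod_type]

theorem sum_adjacencyMatrix_of_regular [Fintype V] (G : SimpleGraph V) [DecidableRel G.Adj]
    {d : ℕ} (hG : G.IsRegularOfDegree d) (φ : V → ℝ) :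
    ∑ u, ∑ v, adjacencyMatrix G u v * φ u = d * ∑ u, φ u := by
  classical
  have hA : adjacencyMatrix G = G.adjMatrix ℝ := by
    unfold adjacencyMatrix; congr
  rw [mul_sum]
  refine sum_congr rfl fun u _ => ?_
  rw [← sum_mul, hA]
  congr 1
  have := hG u
  rw [← this, ← G.card_neighborFinset_eq_degree, SimpleGraph.neighborFinset_eq_filter]
  simp [SimpleGraph.adjMatrix_apply]

theorem sum_adjacencyMatrix_liftGraph_of_regular [Fintype V] (G : SimpleGraph V)
    [DecidableRel G.Adj] {d : ℕ} (hG : G.IsRegularOfDegree d) (n : ℕ) (π : LiftData G n)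
    (φ : Fin n × V → ℝ) :
    ∑ x, ∑ y, adjacencyMatrix (liftGraph G n π) x y * φ x = d * ∑ x, φ x := by
  classical
  rw [sum_adjacencyMatrix_liftGraph_mul G n π fun x _ => φ x, Fintype.sum_prod_type, mul_sum,
    ← sum_congr rfl fun i _ => sum_adjacencyMatrix_of_regular G hG fun u => φ (i, u)]
  simp only [fun i : Fin n => sum_adjacencyMatrix_mul G fun u _ => φ (i, u)]
  rw [sum_comm (s := (univ : Finset (Fin n)))]
  refine sum_congr rfl fun e _ => ?_
  rw [sum_add_distrib, sum_add_distrib]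
  congr 1
  exact Equiv.sum_comp (π e) fun i => φ (i, secondEnd G e)

/-- The mean subtracted in `deviationForm`, summed over both orientations of each edge, is the form
of `G` on the fibre sums divided by `n`. -/
theorem quadratic_form_liftGraph_eq [Fintype V] (G : SimpleGraph V) [Fintype G.edgeSet] (n : ℕ)
    (π : LiftData G n) (f : Fin n × V → ℝ) :
    ∑ x, f x * ∑ y, adjacencyMatrix (liftGraph G n π) x y * f y =
      2 * deviationForm (firstEnd G) (secondEnd G) π f f +
        (∑ u, (∑ i, f (i, u)) * ∑ v, adjacencyMatrix G u v * ∑ i, f (i, v)) / n := by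
  have h1 : ∑ x, f x * ∑ y, adjacencyMatrix (liftGraph G n π) x y * f y =
      ∑ x, ∑ y, adjacencyMatrix (liftGraph G n π) x y * (f x * f y) := by
    simp only [mul_sum]
    exact sum_congr rfl fun x _ => sum_congr rfl fun y _ => by ring
  have h2 : ∑ u, (∑ i, f (i, u)) * ∑ v, adjacencyMatrix G u v * ∑ i, f (i, v) =
      ∑ u, ∑ v, adjacencyMatrix G u v * ((∑ i, f (i, u)) * ∑ i, f (i, v)) := by
    refine sum_congr rfl fun u _ => ?_
    rw [mul_sum]
    exact sum_congr rfl fun v _ => by ring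
  rw [h1, h2, sum_adjacencyMatrix_liftGraph_mul G n π fun x y => f x * f y,
    sum_adjacencyMatrix_mul G fun u v => (∑ i, f (i, u)) * ∑ i, f (i, v), deviationForm, mul_sum,
    sum_div, ← sum_add_distrib]
  refine sum_congr rfl fun e _ => ?_
  have h3 : ∀ i, f (i, firstEnd G e) * f (π e i, secondEnd G e) +
      f (π e i, secondEnd G e) * f (i, firstEnd G e) =
      2 * (f (i, firstEnd G e) * f (π e i, secondEnd G e)) := fun i => by ring
  simp only [h3, ← mul_sum]
  ring

theorem sq_sum_fiber_le [Fintype V] (n : ℕ) (f : Fin n × V → ℝ) :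
    ∑ u, (∑ i, f (i, u)) ^ 2 ≤ n * ∑ x, f x ^ 2 := by
  rw [Fintype.sum_prod_type_right, mul_sum]
  refine sum_le_sum fun u _ => ?_
  have := sq_sum_le_card_mul_sum_sq (s := (univ : Finset (Fin n))) (f := fun i => f (i, u))
  simpa using this

theorem log_le_two_mul_logb_treeSpectralRadius {d : ℕ} (hd : 3 ≤ d) :
    Real.sqrt d ≤ treeSpectralRadius d ∧
      Real.log d ≤ 2 * Real.logb 2 (treeSpectralRadius d) := by
  have hd' : (3 : ℝ) ≤ d := by exact_mod_cast hd
  have h1 : Real.sqrt d ≤ treeSpectralRadius d := by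
    unfold treeSpectralRadius
    rw [Real.sqrt_le_left (by positivity), mul_pow, Real.sq_sqrt (by linarith)]
    linarith
  refine ⟨h1, ?_⟩
  have h2 : Real.log d = 2 * Real.log (Real.sqrt d) := by
    rw [Real.log_sqrt (by linarith)]; ring
  have h3 : 0 ≤ Real.log (Real.sqrt d) :=
    Real.log_nonneg (Real.one_le_sqrt.2 (by linarith))
  have h4 : Real.log (Real.sqrt d) ≤ Real.log (treeSpectralRadius d) :=
    Real.log_le_log (Real.sqrt_pos.2 (by linarith)) h1
  have h5 : Real.log (treeSpectralRadius d) ≤ Real.logb 2 (treeSpectralRadius d) := by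
    rw [Real.logb, le_div_iff₀ (Real.log_pos (by norm_num))]
    have : Real.log 2 ≤ 1 := by linarith [Real.log_two_lt_d9]
    exact mul_le_of_le_one_right (h3.trans h4) this
  linarith

/-- A concentrated lift has small nontrivial eigenvalues. -/
theorem nontrivialEigenvaluesLE_liftGraph [Fintype V] (G : SimpleGraph V) [DecidableRel G.Adj]
    [Fintype G.edgeSet] {d : ℕ} {lam : ℝ} (hd : 3 ≤ d) (hG : G.IsRegularOfDegree d)
    (hlam : NontrivialEigenvaluesLE G lam) {n : ℕ} (hn : 1 ≤ n) {π : LiftData G n}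
    (hπ : ∀ S T : V → Finset (Fin n),
      |∑ e, (hits (firstEnd G) (secondEnd G) S T π e : ℝ) -
          ∑ e, meanHits (firstEnd G) (secondEnd G) S T e| ≤ 2 * pairExponent S T +
        2 * Real.sqrt ((∑ e, meanHits (firstEnd G) (secondEnd G) S T e) * pairExponent S T) ∧
      ∑ e, thinWeight (firstEnd G) (secondEnd G) d S T e *
          hits (firstEnd G) (secondEnd G) S T π e ≤
        ∑ e, (Real.exp (thinWeight (firstEnd G) (secondEnd G) d S T e) - 1) *
          meanHits (firstEnd G) (secondEnd G) S T e + pairExponent S T) :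
    NontrivialEigenvaluesLE (liftGraph G n π)
      (700000 * max lam (treeSpectralRadius d) * Real.logb 2 (treeSpectralRadius d)) := by
  have hd' : (3 : ℝ) ≤ d := by exact_mod_cast hd
  have hn' : (0 : ℝ) < n := by exact_mod_cast hn
  obtain ⟨hρ, hlogb⟩ := log_le_two_mul_logb_treeSpectralRadius hd
  have hlog : 1 ≤ Real.log d := by
    rw [Real.le_log_iff_exp_le (by linarith)]
    linarith [Real.exp_one_lt_d9]
  set α := max lam (treeSpectralRadius d) with hα
  set ℓ := Real.logb 2 (treeSpectralRadius d) with hℓ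
  have hα1 : Real.sqrt d ≤ α := hρ.trans (le_max_right _ _)
  have hα0 : 0 ≤ α := (Real.sqrt_nonneg _).trans hα1
  have hGα : NontrivialEigenvaluesLE G α := fun i hi => (hlam i hi).trans (le_max_left _ _)
  have hreg := sum_adjacencyMatrix_of_regular G hG
  have hends : ∀ x : V → ℝ, ∑ e : G.edgeSet, (x (firstEnd G e) + x (secondEnd G e)) =
      d * ∑ u, x u := fun x => by
    rw [← hreg, sum_adjacencyMatrix_mul G fun u _ => x u]
  have ha : ∀ x : V → ℝ, (∀ u, 0 ≤ x u) → ∑ e : G.edgeSet, x (firstEnd G e) ≤ d * ∑ u, x u :=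
    fun x hx => by
      rw [← hends]
      exact sum_le_sum fun e _ => by linarith [hx (secondEnd G e)]
  have hb : ∀ x : V → ℝ, (∀ u, 0 ≤ x u) → ∑ e : G.edgeSet, x (secondEnd G e) ≤ d * ∑ u, x u :=
    fun x hx => by
      rw [← hends]
      exact sum_le_sum fun e _ => by linarith [hx (firstEnd G e)]
  have hmix : ∀ x y : V → ℝ, (∀ u, 0 ≤ x u) → (∀ u, 0 ≤ y u) →
      ∑ e : G.edgeSet, x (firstEnd G e) * y (secondEnd G e) ≤
        d / Fintype.card V * ((∑ u, x u) * ∑ u, y u) +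
          α * (Real.sqrt (∑ u, x u ^ 2) * Real.sqrt (∑ u, y u ^ 2)) := by
    intro x y hx hy
    refine le_trans ?_ (bilinear_form_le (by positivity) hα0 hreg hGα
      (mul_nonneg (sum_nonneg fun u _ => hx u) (sum_nonneg fun u _ => hy u)))
    have h : ∑ u, x u * ∑ v, adjacencyMatrix G u v * y v =
        ∑ u, ∑ v, adjacencyMatrix G u v * (x u * y v) := by
      simp only [mul_sum]
      exact sum_congr rfl fun u _ => sum_congr rfl fun v _ => by ring
    rw [h, sum_adjacencyMatrix_mul G fun u v => x u * y v]
    exact sum_le_sum fun e _ => by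
      linarith [mul_nonneg (hx (secondEnd G e)) (hy (firstEnd G e))]
  refine nontrivialEigenvaluesLE_of_quadratic_form_le (d := d) (by positivity)
    (sum_adjacencyMatrix_liftGraph_of_regular G hG n π) fun f hf => ?_
  have h1 := abs_deviationForm_le hd hα1 ha hb hmix hn hπ f
  -- The fibre sums inherit total zero, so the spectral bound of `G` applies to them; Cauchy–Schwarz
  -- inside each fibre then absorbs the division by `n`.
  have hF : ∑ u, ∑ i, f (i, u) = 0 := by rw [← hf, Fintype.sum_prod_type_right]
  have h2 : |(∑ u, (∑ i, f (i, u)) * ∑ v, adjacencyMatrix G u v * ∑ i, f (i, v)) / n| ≤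
      α * ∑ x, f x ^ 2 := by
    rw [abs_div, abs_of_pos hn', div_le_iff₀ hn']
    refine (abs_quadratic_form_le (by positivity) hα0 hreg hGα hF).trans ?_
    have := mul_le_mul_of_nonneg_left (sq_sum_fiber_le n f) hα0
    linarith
  have hsum : 0 ≤ ∑ x, f x ^ 2 := sum_nonneg fun _ _ => sq_nonneg _
  rw [quadratic_form_liftGraph_eq]
  have h3 : α * Real.log d ≤ α * (2 * ℓ) := mul_le_mul_of_nonneg_left hlogb hα0
  have h4 : α ≤ α * Real.log d := le_mul_of_one_le_right hα0 hlog
  calc _ ≤ 2 * (150000 * (α * Real.log d) * ∑ x, f x ^ 2) + α * ∑ x, f x ^ 2 := by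
        refine (abs_add_le _ _).trans (add_le_add ?_ h2)
        rw [abs_mul, abs_two]
        linarith
    _ = (300000 * (α * Real.log d) + α) * ∑ x, f x ^ 2 := by ring
    -- Since α ≤ α log d ≤ 2αℓ, the constant needed is 600002 ≤ 700000.
    _ ≤ _ := mul_le_mul_of_nonneg_right (by linarith) hsum

theorem liftProbability_nontrivialEigenvalues_le [Fintype V] (G : SimpleGraph V)
    [DecidableRel G.Adj] {d : ℕ} {lam : ℝ} (hd : 3 ≤ d) (hG : G.IsRegularOfDegree d)
    (hlam : NontrivialEigenvaluesLE G lam) {n : ℕ} (hn : 1 ≤ n) (hm : Fintype.card V ≤ n) :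
    liftProbability G n (fun H => ¬NontrivialEigenvaluesLE H
      (700000 * max lam (treeSpectralRadius d) * Real.logb 2 (treeSpectralRadius d))) ≤
      3 * Real.exp 2 / (n : ℝ) ^ 100 := by
  classical
  have hcount := card_not_concentrated_le (firstEnd G) (secondEnd G) hn hm
    (thinWeight (firstEnd G) (secondEnd G) d)
  unfold liftProbability
  have hpos : (0 : ℝ) < Nat.card (LiftData G n) := by exact_mod_cast Nat.card_pos
  rw [div_le_iff₀ hpos]
  refine le_trans ?_ (hcount.trans_eq (mul_comm _ _))
  rw [Nat.cast_le]
  refine Nat.card_le_card_of_injective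
    (Subtype.map id fun π hπ hgood => hπ (nontrivialEigenvaluesLE_liftGraph G hd hG hlam hn hgood))
    (Subtype.map_injective _ Function.injective_id)

theorem liftProbability_le_one [Finite V] (G : SimpleGraph V) (n : ℕ)
    (E : SimpleGraph (Fin n × V) → Prop) : liftProbability G n E ≤ 1 := by
  refine div_le_one_of_le₀ ?_ (by positivity)
  exact_mod_cast Nat.card_le_card_of_injective _ Subtype.val_injective

end

/-! ### Assembly of the theorem. -/

theorem theorem1 :
    ∃ C K : ℝ, 0 < C ∧
      ∀ (V : Type*) [Fintype V] (G : SimpleGraph V) [DecidableRel G.Adj] (d : ℕ) (lam : ℝ),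
        3 ≤ d → G.IsRegularOfDegree d → NontrivialEigenvaluesLE G lam →
        (∃ K' : ℝ, ∀ n : ℕ, 1 ≤ n →
          liftProbability G n (fun H =>
            ¬ NontrivialEigenvaluesLE H
              (C * max lam (treeSpectralRadius d) * Real.logb 2 (treeSpectralRadius d))) ≤
            K' / (n : ℝ) ^ 100) ∧
        (∀ n : ℕ, (Fintype.card V : ℝ) ^ (3 / 2 : ℝ) ≤ (n : ℝ) →
          liftProbability G n (fun H =>
            ¬ NontrivialEigenvaluesLE H
              (C * max lam (treeSpectralRadius d) * Real.logb 2 (treeSpectralRadius d))) ≤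
            K / (n : ℝ) ^ 100) := by
  refine ⟨700000, 3 * Real.exp 2, by norm_num, ?_⟩
  intro V _ G _ d lam hd hG hlam
  -- For n ≤ m the term m¹⁰⁰ makes the bound exceed 1, hence trivial.
  refine ⟨⟨3 * Real.exp 2 + (Fintype.card V : ℝ) ^ 100, fun n hn => ?_⟩, fun n hmn => ?_⟩
  · have hn' : (0 : ℝ) < n := by exact_mod_cast hn
    rcases le_total (Fintype.card V) n with hm | hm
    · refine (liftProbability_nontrivialEigenvalues_le G hd hG hlam hn hm).trans ?_
      gcongr
      have : (0 : ℝ) ≤ (Fintype.card V : ℝ) ^ 100 := by positivity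
      linarith
    · refine (liftProbability_le_one G n _).trans ?_
      rw [le_div_iff₀ (by positivity), one_mul]
      have h1 : (n : ℝ) ^ 100 ≤ (Fintype.card V : ℝ) ^ 100 := by gcongr
      have h2 := Real.exp_pos 2
      linarith
  -- Only m ≤ n is needed, and m ≤ m^(3/2) supplies it.
  · have hm : Fintype.card V ≤ n := by
      rcases Nat.eq_zero_or_pos (Fintype.card V) with h0 | hpos
      · omega
      · have h1 : (1 : ℝ) ≤ Fintype.card V := by exact_mod_cast hpos
        have h2 := Real.self_le_rpow_of_one_le h1 (show (1 : ℝ) ≤ 3 / 2 by norm_num)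
        exact_mod_cast h2.trans hmn
    rcases Nat.eq_zero_or_pos n with rfl | hn
    -- For n = 0 the right side is K/0 = 0, so the probability must vanish exactly; it does, because
    -- the lift has no vertices and hence no eigenvalues.
    · have hempty : IsEmpty {π : LiftData G 0 // ¬NontrivialEigenvaluesLE (liftGraph G 0 π)
          (700000 * max lam (treeSpectralRadius d) * Real.logb 2 (treeSpectralRadius d))} :=
        ⟨fun π => π.2 fun i => absurd i.2 (by simp)⟩
      unfold liftProbability
      rw [Nat.card_of_isEmpty]
      simp
    · exact liftProbability_nontrivialEigenvalues_le G hd hG hlam hn hm
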